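/- Let $E$ be a category with finite limits. A morphism $f\colon B\to A$ of $E$ is \emph{exponentiable} if the pullback functor $f^*\colon E/A\to E/B$ has a right adjoint $\Pi_f$. \emph{Polynomials.} A polynomial $p$ in $E$ is an exponentiable morphism $p\colon P_*\to P$. A morphism of polynomials $\phi\colon p\to q$ is a morphism $\phi_1\colon P\to Q$ together with a morphism $\phi^\sharp\colon P\times_Q Q_*\to P_*$ over $P$, where the pullback is formed along $\phi_1$ and $q$ (and pairs that differ only by the choice of this pullback are identified). The identity of $p$ is given by $\mathrm{id}_P$ and $P\times_P P_*\cong P_*$; the composite of $\phi\colon p\to q$ and $\psi\colon q\to r$ is given by $\psi_1\circ\phi_1$ and, on generalized elements, by $(x,z)\mapsto \phi^\sharp(x,\psi^\sharp(\phi_1(x),z))$. Let $\mathbf{Poly}_E$ be the resulting category. It is monoidal: the unit $y$ is $\mathrm{id}_1\colon 1\to 1$, and $p\triangleleft q$ is the composite of projections $$\bigl(\Pi_p(Q\times P_*)\times_P P_*\bigr)\times_Q Q_*\longrightarrow \Pi_p(Q\times P_*)\times_P P_*\longrightarrow \Pi_p(Q\times P_*),$$ where $Q \times P_*$ is regarded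 as an object over $P_*$ and the pullback over $Q$ is formed along $q$ and the composite of the evaluation $\Pi_p(Q\times P_*)\times_P P_*\to Q\times P_*$ with the projection to $Q$. In generalized elements, a position of $p\triangleleft q$ is a position $I$ of $p$ together with a map $J$ from the fibre $p[I]$ of $p$ over $I$ to $Q$, and a direction at $(I,J)$ is a direction $u$ of $p$ at $I$ together with a direction of $q$ at $J(u)$; the action of $\triangleleft$ on morphisms and the associativity and unit isomorphisms are the evident ones in these terms. \emph{Comonoids.} A $\triangleleft$-comonoid is a polynomial $c$ with morphisms $\epsilon\colon c\to y$ and $\delta\colon c\to c\triangleleft c$ that satisfy the counit and coassociativity laws; a homomorphism is a morphism of polynomials that commutes with the counits and the comultiplications. $\mathbf{Comon}(\mathbf{Poly}_E)$ is the category of $\triangleleft$-comonoids and homomorphisms. \emph{Internal categories.} A category $C$ internal to $E$ consists of $s,t\colon C_1\to C_0$, $i\colon C_0\to C_1$ and $k\colon C_1\times_{t,s}C_1\to C_1$ with $s i=\mathrm{id}=t i$, $s k=s\pi_1$, $t k=t\pi_2$ that satisfy the unit laws $k(i s(f),f)=f=k(f,i t(f))$ and the associative law $k(k(f,g),h)=k(f,k(g,h))$.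 An internal cofunctor $\phi\colon C\to C'$ is a morphism $\phi_1\colon C_0\to C_0'$ together with a morphism $\phi^\sharp\colon C_0\times_{\phi_1,s'}C_1'\to C_1$ over $C_0$ (that is, $s\phi^\sharp=\pi_1$; again up to the choice of the pullback) such that, on generalized elements, $$\phi^\sharp(x,i'(\phi_1(x)))=i(x),\qquad \phi_1(t(\phi^\sharp(x,f)))=t'(f),\qquad \phi^\sharp(x,k'(f,g))=k\bigl(\phi^\sharp(x,f),\phi^\sharp(t(\phi^\sharp(x,f)),g)\bigr).$$ Identities and composites of internal cofunctors are defined by the formulas for morphisms of polynomials. \textbf{Statement.} Internal categories in $E$ whose source morphism $s$ is exponentiable, with internal cofunctors as morphisms, form a category that is isomorphic to $\mathbf{Comon}(\mathbf{Poly}_E)$. Moreover, there is an isomorphism of categories that sends a comonoid with underlying polynomial $c$ to an internal category whose source morphism is $c$, and a homomorphism with underlying morphism of polynomials $(\phi_1,\phi^\sharp)$ to the internal cofunctor given by the same pair $(\phi_1,\phi^\sharp)$. -/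

import Mathlib

open CategoryTheory CategoryTheory.Limits

universe v u

namespace PolyComon

noncomputable section

attribute [local simp] pullback.lift_fst pullback.lift_fst_assoc pullback.lift_snd
  pullback.lift_snd_assoc

section Exponentiable

variable {E : Type u} [Category.{v} E] [HasPullbacks E]

/-- A morphism is exponentiable if pulling back along it has a right adjoint. -/
def IsExponentiable {A B : E} (f : B ⟶ A) : Prop :=
  (Over.pullback f).IsLeftAdjoint

theorem IsExponentiable.id (A : E) : IsExponentiable (𝟙 A) := by
  unfold IsExponentiable
  exact Functor.isLeftAdjoint_of_iso (Over.pullbackId (X := A)).symm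

theorem IsExponentiable.comp {A B C : E} {f : B ⟶ A} {g : C ⟶ B}
    (hf : IsExponentiable f) (hg : IsExponentiable g) : IsExponentiable (g ≫ f) := by
  unfold IsExponentiable at *
  exact Functor.isLeftAdjoint_of_iso (Over.pullbackComp g f).symm

section

variable {A B A' : E} (f : B ⟶ A) (g : A' ⟶ A)

/-- The map `X ×_A B ⟶ A' ×_A B` over `B`, for `X` over `A'`. -/
def slicedObj {X : E} (a : X ⟶ A') : pullback (a ≫ g) f ⟶ pullback g f :=
  pullback.lift (pullback.fst (a ≫ g) f ≫ a) (pullback.snd (a ≫ g) f)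
    (by simp [pullback.condition])

/-- The functoriality of `X ×_A B` in `X` over `A'`. -/
def slicedMap {X Y : E} (a : X ⟶ A') (b : Y ⟶ A') (h : X ⟶ Y) (w : h ≫ b = a) :
    pullback (a ≫ g) f ⟶ pullback (b ≫ g) f :=
  pullback.lift (pullback.fst (a ≫ g) f ≫ h) (pullback.snd (a ≫ g) f)
    (by simp [← w, ← pullback.condition])

theorem slicedMap_obj {X Y : E} (a : X ⟶ A') (b : Y ⟶ A') (h : X ⟶ Y) (w : h ≫ b = a) :
    slicedMap f g a b h w ≫ slicedObj f g b = slicedObj f g a := by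
  apply pullback.hom_ext <;> simp [slicedMap, slicedObj, w]

/-- The functor `Over A' ⥤ Over (A' ×_A B)` that pulls back along `f` in the slices. -/
def slicedPullback : Over A' ⥤ Over (pullback g f) where
  obj X := Over.mk (slicedObj f g X.hom)
  map {X Y} h := Over.homMk (slicedMap f g X.hom Y.hom h.left (Over.w h))
    (slicedMap_obj f g _ _ _ _)
  map_id X := by
    ext1
    change slicedMap f g X.hom X.hom (𝟙 X.left) (Category.id_comp _) = 𝟙 _
    apply pullback.hom_ext <;> simp [slicedMap]
  map_comp {X Y Z} h k := by
    ext1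
    change slicedMap f g X.hom Z.hom (h.left ≫ k.left) (Over.w (h ≫ k)) =
      slicedMap f g X.hom Y.hom h.left (Over.w h) ≫ slicedMap f g Y.hom Z.hom k.left (Over.w k)
    apply pullback.hom_ext <;> simp [slicedMap]

theorem slicedObj_iso {X : E} (a : X ⟶ A') :
    (pullbackRightPullbackFstIso g f a).inv ≫ pullback.snd a (pullback.fst g f) =
      slicedObj f g a := by
  apply pullback.hom_ext <;> simp [slicedObj, ← pullback.condition]

theorem slicedMap_iso {X Y : E} (a : X ⟶ A') (b : Y ⟶ A') (h : X ⟶ Y) (w : h ≫ b = a) :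
    slicedMap f g a b h w ≫ (pullbackRightPullbackFstIso g f b).inv =
      (pullbackRightPullbackFstIso g f a).inv ≫
        pullback.lift (pullback.fst a (pullback.fst g f) ≫ h) (pullback.snd a (pullback.fst g f))
          (by simp [w, pullback.condition]) := by
  apply pullback.hom_ext
  · simp [slicedMap]
  · apply pullback.hom_ext <;> simp [slicedMap, ← pullback.condition, w]

end

theorem IsExponentiable.pullback_fst {A B A' : E} {f : B ⟶ A} (hf : IsExponentiable f)
    (g : A' ⟶ A) : IsExponentiable (pullback.fst g f) := by
  unfold IsExponentiable at *
  let F : Over A' ⥤ Over (pullback g f) :=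
    (Over.iteratedSliceEquiv (Over.mk g)).inverse ⋙ Over.post (Over.pullback f) ⋙
      (Over.iteratedSliceEquiv ((Over.pullback f).obj (Over.mk g))).functor
  have hF : F.IsLeftAdjoint := by
    dsimp only [F]
    infer_instance
  have e : F = slicedPullback f g := rfl
  rw [e] at hF
  refine Functor.isLeftAdjoint_of_iso (F := slicedPullback f g) ?_
  refine NatIso.ofComponents
    (fun X => Over.isoMk (pullbackRightPullbackFstIso g f X.hom).symm
      (slicedObj_iso f g X.hom)) ?_
  intro X Y h
  ext1
  exact slicedMap_iso f g X.hom Y.hom h.left (Over.w h)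

end Exponentiable

theorem comp_lift {E : Type u} [Category.{v} E] [HasPullbacks E] {C B X Y Z : E} {f : X ⟶ Z}
    {g : Y ⟶ Z} (w : C ⟶ B) (a : B ⟶ X) (b : B ⟶ Y) (h : a ≫ f = b ≫ g) :
    w ≫ pullback.lift a b h = pullback.lift (w ≫ a) (w ≫ b) (by simp [h]) := by
  apply pullback.hom_ext <;> simp

variable {E : Type u} [Category.{v} E] [HasFiniteLimits E]

variable (E) in
/-- A polynomial in `E`: an exponentiable morphism `hom : dir ⟶ pos`. -/
structure Poly where
  /-- the object of positions -/
  pos : E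
  /-- the object of directions -/
  dir : E
  /-- the morphism -/
  hom : dir ⟶ pos
  exp : IsExponentiable hom

namespace Poly

/-- A morphism of polynomials. An isomorphism class of the defining diagrams, where the
isomorphisms are between choices of the pullback of `q.hom` along `pos`, has exactly one member
whose pullback is the chosen one. -/
structure Hom (p q : Poly E) where
  /-- the component on positions -/
  pos : p.pos ⟶ q.pos
  /-- the component on directions -/
  dir : pullback pos q.hom ⟶ p.dir
  dir_hom : dir ≫ p.hom = pullback.fst pos q.hom

namespace Hom

variable {p q r : Poly E}

/-- The action on generalized elements of the component on directions. -/
def app (φ : Hom p q) {B : E} (x : B ⟶ p.pos) (y : B ⟶ q.dir) (h : x ≫ φ.pos = y ≫ q.hom) :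
    B ⟶ p.dir :=
  pullback.lift x y h ≫ φ.dir

@[simp]
theorem app_hom (φ : Hom p q) {B : E} (x : B ⟶ p.pos) (y : B ⟶ q.dir)
    (h : x ≫ φ.pos = y ≫ q.hom) : φ.app x y h ≫ p.hom = x := by
  simp [app, φ.dir_hom]

@[simp]
theorem app_hom_assoc (φ : Hom p q) {B Z : E} (x : B ⟶ p.pos) (y : B ⟶ q.dir)
    (h : x ≫ φ.pos = y ≫ q.hom) (k : p.pos ⟶ Z) : φ.app x y h ≫ p.hom ≫ k = x ≫ k := by
  rw [← Category.assoc, app_hom]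

@[simp]
theorem comp_app (φ : Hom p q) {B C : E} (w : C ⟶ B) (x : B ⟶ p.pos) (y : B ⟶ q.dir)
    (h : x ≫ φ.pos = y ≫ q.hom) :
    w ≫ φ.app x y h = φ.app (w ≫ x) (w ≫ y) (by simp [h]) := by
  simp only [app, ← Category.assoc, comp_lift]

theorem dir_eq (φ : Hom p q) : φ.dir = φ.app (pullback.fst _ _) (pullback.snd _ _)
    pullback.condition := by
  have : pullback.lift (pullback.fst φ.pos q.hom) (pullback.snd φ.pos q.hom)
      pullback.condition = 𝟙 _ := by
    apply pullback.hom_ext <;> simp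
  simp [app, this]

theorem ext_app {φ ψ : Hom p q} (h₁ : φ.pos = ψ.pos)
    (h₂ : ∀ (B : E) (x : B ⟶ p.pos) (y : B ⟶ q.dir) (h : x ≫ φ.pos = y ≫ q.hom)
      (h' : x ≫ ψ.pos = y ≫ q.hom), φ.app x y h = ψ.app x y h') : φ = ψ := by
  have a := dir_eq φ
  have b := dir_eq ψ
  obtain ⟨f, d, e⟩ := φ
  obtain ⟨f', d', e'⟩ := ψ
  obtain rfl : f = f' := h₁
  obtain rfl : d = d' := by
    exact a.trans ((h₂ _ _ _ _ pullback.condition).trans b.symm)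
  rfl

/-- A morphism of polynomials from its component on positions and a natural action on
generalized elements. -/
def ofElements (f : p.pos ⟶ q.pos)
    (F : ∀ (B : E) (x : B ⟶ p.pos) (y : B ⟶ q.dir), x ≫ f = y ≫ q.hom → (B ⟶ p.dir))
    (hF : ∀ (B : E) (x : B ⟶ p.pos) (y : B ⟶ q.dir) (h : x ≫ f = y ≫ q.hom),
      F B x y h ≫ p.hom = x) : Hom p q where
  pos := f
  dir := F _ (pullback.fst f q.hom) (pullback.snd f q.hom) pullback.condition
  dir_hom := hF _ _ _ _

theorem ofElements_app (f : p.pos ⟶ q.pos)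
    (F : ∀ (B : E) (x : B ⟶ p.pos) (y : B ⟶ q.dir), x ≫ f = y ≫ q.hom → (B ⟶ p.dir))
    (hF : ∀ (B : E) (x : B ⟶ p.pos) (y : B ⟶ q.dir) (h : x ≫ f = y ≫ q.hom),
      F B x y h ≫ p.hom = x)
    (nat : ∀ (B C : E) (w : C ⟶ B) (x : B ⟶ p.pos) (y : B ⟶ q.dir) (h : x ≫ f = y ≫ q.hom),
      w ≫ F B x y h = F C (w ≫ x) (w ≫ y) (by simp [h]))
    {B : E} (x : B ⟶ p.pos) (y : B ⟶ q.dir) (h : x ≫ f = y ≫ q.hom) :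
    (ofElements f F hF).app x y h = F B x y h := by
  change pullback.lift x y h ≫ F _ _ _ _ = _
  rw [nat]
  congr 1 <;> simp

/-- The identity morphism. -/
def id (p : Poly E) : Hom p p where
  pos := 𝟙 p.pos
  dir := pullback.snd (𝟙 p.pos) p.hom
  dir_hom := by simp [← pullback.condition]

/-- The composite of morphisms of polynomials. Its component on directions is the composite of
`p.pos ×_{r.pos} r.dir ⟶ p.pos ×_{q.pos} q.dir`, induced by `ψ`, with that of `φ`. -/
def comp (φ : Hom p q) (ψ : Hom q r) : Hom p r where
  pos := φ.pos ≫ ψ.pos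
  dir := φ.app (pullback.fst (φ.pos ≫ ψ.pos) r.hom)
    (ψ.app (pullback.fst (φ.pos ≫ ψ.pos) r.hom ≫ φ.pos) (pullback.snd (φ.pos ≫ ψ.pos) r.hom)
      (by simp [← pullback.condition])) (by simp)
  dir_hom := by simp

theorem id_app (p : Poly E) {B : E} (x : B ⟶ p.pos) (y : B ⟶ p.dir)
    (h : x ≫ (Hom.id p).pos = y ≫ p.hom) : (Hom.id p).app x y h = y :=
  pullback.lift_snd _ _ _

theorem app_congr (φ : Hom p q) {B : E} {x x' : B ⟶ p.pos} {y y' : B ⟶ q.dir}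
    (h : x ≫ φ.pos = y ≫ q.hom) (hx : x = x') (hy : y = y') :
    φ.app x y h = φ.app x' y' (by rw [← hx, ← hy, h]) := by
  subst hx hy
  rfl

theorem comp_app' (φ : Hom p q) (ψ : Hom q r) {B : E} (x : B ⟶ p.pos) (y : B ⟶ r.dir)
    (h : x ≫ (Hom.comp φ ψ).pos = y ≫ r.hom) :
    (Hom.comp φ ψ).app x y h =
      φ.app x (ψ.app (x ≫ φ.pos) y (by simpa [comp] using h)) (by simp) := by
  have h' : x ≫ φ.pos ≫ ψ.pos = y ≫ r.hom := h
  change (pullback.lift x y h' : B ⟶ pullback (φ.pos ≫ ψ.pos) r.hom) ≫ φ.app _ _ _ = _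
  rw [comp_app]
  refine app_congr _ _ (pullback.lift_fst _ _ _) ?_
  rw [comp_app]
  refine app_congr _ _ ?_ (pullback.lift_snd _ _ _)
  rw [← Category.assoc, pullback.lift_fst]

end Hom

instance : Category (Poly E) where
  Hom p q := Hom p q
  id p := Hom.id p
  comp φ ψ := Hom.comp φ ψ
  id_comp φ := by
    refine Hom.ext_app (Category.id_comp _) ?_
    intro B x y h h'
    rw [Hom.comp_app', Hom.id_app]
    exact Hom.app_congr _ _ (Category.comp_id _) rfl
  comp_id φ := by
    refine Hom.ext_app (Category.comp_id _) ?_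
    intro B x y h h'
    rw [Hom.comp_app']
    exact Hom.app_congr _ _ rfl (Hom.id_app _ _ _ _)
  assoc φ ψ χ := by
    refine Hom.ext_app (Category.assoc _ _ _) ?_
    intro B x y h h'
    rw [Hom.comp_app', Hom.comp_app', Hom.comp_app']
    refine Hom.app_congr _ _ rfl ?_
    rw [Hom.comp_app']
    exact Hom.app_congr _ _ rfl (Hom.app_congr _ _ (Category.assoc _ _ _).symm rfl)

variable {p q r : Poly E}

@[simp] theorem id_pos (p : Poly E) : Hom.pos (𝟙 p) = 𝟙 p.pos := rfl

@[simp] theorem comp_pos (φ : p ⟶ q) (ψ : q ⟶ r) :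
    Hom.pos (φ ≫ ψ) = Hom.pos φ ≫ Hom.pos ψ := rfl

@[simp] theorem id_app (p : Poly E) {B : E} (x : B ⟶ p.pos) (y : B ⟶ p.dir)
    (h : x ≫ Hom.pos (𝟙 p) = y ≫ p.hom) : Hom.app (𝟙 p) x y h = y := by
  exact Hom.id_app p x y h

@[simp] theorem comp_app (φ : p ⟶ q) (ψ : q ⟶ r) {B : E} (x : B ⟶ p.pos) (y : B ⟶ r.dir)
    (h : x ≫ Hom.pos (φ ≫ ψ) = y ≫ r.hom) :
    Hom.app (φ ≫ ψ) x y h =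
      Hom.app φ x (Hom.app ψ (x ≫ Hom.pos φ) y (by simpa using h)) (by simp) := by
  exact Hom.comp_app' φ ψ x y h

theorem hom_ext {φ ψ : p ⟶ q} (h₁ : Hom.pos φ = Hom.pos ψ)
    (h₂ : ∀ (B : E) (x : B ⟶ p.pos) (y : B ⟶ q.dir) (h : x ≫ Hom.pos φ = y ≫ q.hom)
      (h' : x ≫ Hom.pos ψ = y ≫ q.hom), Hom.app φ x y h = Hom.app ψ x y h') : φ = ψ :=
  Hom.ext_app h₁ h₂


/-- The identity polynomial `𝟙 : 1 ⟶ 1`. -/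
def y : Poly E where
  pos := ⊤_ E
  dir := ⊤_ E
  hom := 𝟙 _
  exp := IsExponentiable.id _

section Tri

variable (p q)

/-- The object `q.pos × p.dir` over `p.dir`. -/
def prodOver : Over p.dir := Over.mk (prod.snd : q.pos ⨯ p.dir ⟶ p.dir)

/-- The dependent product of `q.pos × p.dir` along `p.hom`. -/
def piOver : Over p.pos :=
  haveI : (Over.pullback p.hom).IsLeftAdjoint := p.exp
  (Over.pullback p.hom).rightAdjoint.obj (prodOver p q)

/-- The adjunction between pullback and dependent product along `p.hom`. -/
def piEquiv (X : Over p.pos) :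
    ((Over.pullback p.hom).obj X ⟶ prodOver p q) ≃ (X ⟶ piOver p q) :=
  haveI : (Over.pullback p.hom).IsLeftAdjoint := p.exp
  (Adjunction.ofIsLeftAdjoint (Over.pullback p.hom)).homEquiv X (prodOver p q)

theorem piEquiv_naturality {X Y : Over p.pos} (w : Y ⟶ X)
    (f : (Over.pullback p.hom).obj X ⟶ prodOver p q) :
    piEquiv p q Y ((Over.pullback p.hom).map w ≫ f) = w ≫ piEquiv p q X f :=
  haveI : (Over.pullback p.hom).IsLeftAdjoint := p.exp
  Adjunction.homEquiv_naturality_left _ _ _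

/-- The projection from the dependent product to the positions of `p`. -/
def triπ : (piOver p q).left ⟶ p.pos := (piOver p q).hom

/-- The counit of the adjunction, followed by the projection to `q.pos`. -/
def piEval : pullback (triπ p q) p.hom ⟶ q.pos :=
  ((piEquiv p q (piOver p q)).symm (𝟙 _)).left ≫ (prod.fst : q.pos ⨯ p.dir ⟶ q.pos)

/-- The composite
`(Π_p (q.pos × p.dir) ×_{p.pos} p.dir) ×_{q.pos} q.dir ⟶ Π_p (q.pos × p.dir) ×_{p.pos} p.dir
  ⟶ Π_p (q.pos × p.dir)`
of a pullback of `q` and a pullback of `p`. -/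
def triHom : pullback (piEval p q) q.hom ⟶ (piOver p q).left :=
  pullback.fst (piEval p q) q.hom ≫ pullback.fst (triπ p q) p.hom

/-- The composition product `p ◁ q`. -/
abbrev tri : Poly E where
  pos := (piOver p q).left
  dir := pullback (piEval p q) q.hom
  hom := triHom p q
  exp := (p.exp.pullback_fst _).comp (q.exp.pullback_fst _)

/-- The projection from the directions of `p ◁ q` to those of `p`. -/
def triU : (tri p q).dir ⟶ p.dir :=
  pullback.fst (piEval p q) q.hom ≫ pullback.snd (triπ p q) p.hom

/-- The projection from the directions of `p ◁ q` to those of `q`. -/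
def triV : (tri p q).dir ⟶ q.dir := pullback.snd (piEval p q) q.hom

variable {p q}

/-- Evaluation of a position of `p ◁ q` at a direction of `p`. -/
def ev {B : E} (t : B ⟶ (tri p q).pos) (u : B ⟶ p.dir) (h : t ≫ triπ p q = u ≫ p.hom) :
    B ⟶ q.pos :=
  pullback.lift (f := triπ p q) t u h ≫ piEval p q

theorem ev_def {B : E} (t : B ⟶ (tri p q).pos) (u : B ⟶ p.dir)
    (h : t ≫ triπ p q = u ≫ p.hom) :
    ev t u h = pullback.lift (f := triπ p q) t u h ≫ piEval p q := rfl

/-- A direction of `p ◁ q` is a direction of `p` and one of `q`, at corresponding positions. -/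
def triDir {B : E} (t : B ⟶ (tri p q).pos) (u : B ⟶ p.dir) (v : B ⟶ q.dir)
    (h : t ≫ triπ p q = u ≫ p.hom) (h' : ev t u h = v ≫ q.hom) : B ⟶ (tri p q).dir :=
  pullback.lift (f := piEval p q) (pullback.lift (f := triπ p q) t u h) v
    ((ev_def t u h).symm.trans h')

/-- A position of `p ◁ q` is a position `σ` of `p` with a map from its directions to the
positions of `q`. -/
def triPos {B : E} (σ : B ⟶ p.pos) (f : pullback σ p.hom ⟶ q.pos) : B ⟶ (tri p q).pos :=
  (piEquiv p q (Over.mk σ) (Over.homMk (V := prodOver p q)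
    (prod.lift f (pullback.snd σ p.hom) : pullback σ p.hom ⟶ q.pos ⨯ p.dir)
    (prod.lift_snd _ _))).left

theorem comp_ev {B C : E} (w : C ⟶ B) (t : B ⟶ (tri p q).pos) (u : B ⟶ p.dir)
    (h : t ≫ triπ p q = u ≫ p.hom) :
    w ≫ ev t u h = ev (w ≫ t) (w ≫ u) (by simp [h]) := by
  unfold ev
  rw [← Category.assoc, comp_lift]

theorem comp_triDir {B C : E} (w : C ⟶ B) (t : B ⟶ (tri p q).pos) (u : B ⟶ p.dir)
    (v : B ⟶ q.dir) (h : t ≫ triπ p q = u ≫ p.hom) (h' : ev t u h = v ≫ q.hom) :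
    w ≫ triDir t u v h h' = triDir (w ≫ t) (w ≫ u) (w ≫ v) (by simp [h])
      (by rw [← comp_ev, h', Category.assoc]; exact h) := by
  apply pullback.hom_ext
  · apply pullback.hom_ext <;> simp [triDir]
  · simp [triDir]

theorem triPos_π {B : E} (σ : B ⟶ p.pos) (f : pullback σ p.hom ⟶ q.pos) :
    triPos σ f ≫ triπ p q = σ :=
  Over.w (piEquiv p q (Over.mk σ) _)

theorem triDir_hom {B : E} (t : B ⟶ (tri p q).pos) (u : B ⟶ p.dir) (v : B ⟶ q.dir)
    (h : t ≫ triπ p q = u ≫ p.hom) (h' : ev t u h = v ≫ q.hom) :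
    triDir t u v h h' ≫ triHom p q = t := by
  unfold triDir triHom
  rw [pullback.lift_fst_assoc, pullback.lift_fst]

theorem triDir_U {B : E} (t : B ⟶ (tri p q).pos) (u : B ⟶ p.dir) (v : B ⟶ q.dir)
    (h : t ≫ triπ p q = u ≫ p.hom) (h' : ev t u h = v ≫ q.hom) :
    triDir t u v h h' ≫ triU p q = u := by
  unfold triDir triU
  rw [pullback.lift_fst_assoc, pullback.lift_snd]

theorem triDir_V {B : E} (t : B ⟶ (tri p q).pos) (u : B ⟶ p.dir) (v : B ⟶ q.dir)
    (h : t ≫ triπ p q = u ≫ p.hom) (h' : ev t u h = v ≫ q.hom) :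
    triDir t u v h h' ≫ triV p q = v :=
  pullback.lift_snd _ _ _

theorem triU_hom : triU p q ≫ p.hom = triHom p q ≫ triπ p q := by
  rw [triU, triHom, Category.assoc, ← pullback.condition, ← Category.assoc]

theorem triV_hom : triV p q ≫ q.hom = ev (triHom p q) (triU p q) triU_hom.symm := by
  refine pullback.condition.symm.trans ?_
  unfold ev
  congr 1
  apply pullback.hom_ext
  · rw [pullback.lift_fst]
    rfl
  · rw [pullback.lift_snd]
    rfl

theorem triDir_ext {B : E} {d d' : B ⟶ (tri p q).dir}
    (h₁ : d ≫ triHom p q = d' ≫ triHom p q) (h₂ : d ≫ triU p q = d' ≫ triU p q)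
    (h₃ : d ≫ triV p q = d' ≫ triV p q) : d = d' := by
  refine pullback.hom_ext (pullback.hom_ext ?_ ?_) h₃
  · simpa only [triHom, Category.assoc] using h₁
  · simpa only [triU, Category.assoc] using h₂

theorem piEval_eq : piEval p q =
    (((piEquiv p q (piOver p q)).symm (𝟙 _)).left ≫ (prod.fst : q.pos ⨯ p.dir ⟶ q.pos) :
      pullback (triπ p q) p.hom ⟶ q.pos) := rfl

theorem map_comp_piEquiv_symm {X : Over p.pos} (w : X ⟶ piOver p q) :
    (Over.pullback p.hom).map w ≫ (piEquiv p q (piOver p q)).symm (𝟙 _) =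
      (piEquiv p q X).symm w := by
  apply (piEquiv p q X).injective
  rw [piEquiv_naturality]
  simp

theorem map_piEval {X : Over p.pos} (w : X ⟶ piOver p q) :
    pullback.lift (f := triπ p q) (pullback.fst X.hom p.hom ≫ w.left) (pullback.snd X.hom p.hom)
      ((Category.assoc _ _ _).trans (by
        rw [← pullback.condition]
        exact congrArg (fun k => pullback.fst X.hom p.hom ≫ k) (Over.w w))) ≫ piEval p q =
      ((piEquiv p q X).symm w).left ≫ (prod.fst : q.pos ⨯ p.dir ⟶ q.pos) := by
  have := congrArg (fun k => k.left ≫ (prod.fst : q.pos ⨯ p.dir ⟶ q.pos))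
    (map_comp_piEquiv_symm w)
  refine Eq.trans ?_ this
  exact (Category.assoc _ _ _).symm

theorem triPos_piEval {B : E} (σ : B ⟶ p.pos) (f : pullback σ p.hom ⟶ q.pos)
    (h : (pullback.fst σ p.hom ≫ triPos σ f) ≫ triπ p q = pullback.snd σ p.hom ≫ p.hom) :
    ev (pullback.fst σ p.hom ≫ triPos σ f) (pullback.snd σ p.hom) h = f := by
  have := map_piEval (piEquiv p q (Over.mk σ) (Over.homMk (V := prodOver p q)
    (prod.lift f (pullback.snd σ p.hom) : pullback σ p.hom ⟶ q.pos ⨯ p.dir)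
    (prod.lift_snd _ _)))
  refine Eq.trans ?_ (this.trans ?_)
  · rfl
  · rw [Equiv.symm_apply_apply]
    exact prod.lift_fst _ _

theorem ev_congr {B : E} {t t' : B ⟶ (tri p q).pos} {u u' : B ⟶ p.dir}
    (h : t ≫ triπ p q = u ≫ p.hom) (ht : t = t') (hu : u = u') :
    ev t u h = ev t' u' (by rw [← ht, ← hu, h]) := by
  subst ht hu
  rfl

theorem ev_comp_triPos {B C : E} (w : C ⟶ B) (σ : B ⟶ p.pos) (f : pullback σ p.hom ⟶ q.pos)
    (u : C ⟶ p.dir) (h : (w ≫ triPos σ f) ≫ triπ p q = u ≫ p.hom) :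
    ev (w ≫ triPos σ f) u h = pullback.lift w u
      (by rw [← h, Category.assoc, triPos_π]) ≫ f := by
  have h' : (pullback.fst σ p.hom ≫ triPos σ f) ≫ triπ p q = pullback.snd σ p.hom ≫ p.hom := by
    rw [Category.assoc, triPos_π, pullback.condition]
  refine Eq.trans ?_ (congrArg (fun k => pullback.lift w u
    (by rw [← h, Category.assoc, triPos_π]) ≫ k) (triPos_piEval σ f h'))
  rw [comp_ev]
  refine ev_congr _ ?_ ?_
  · simp
  · simp

theorem ev_triPos {B : E} (σ : B ⟶ p.pos) (f : pullback σ p.hom ⟶ q.pos) (u : B ⟶ p.dir)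
    (h : triPos σ f ≫ triπ p q = u ≫ p.hom) :
    ev (triPos σ f) u h = pullback.lift (𝟙 B) u
      (by rw [Category.id_comp, ← h, triPos_π]) ≫ f := by
  rw [← ev_comp_triPos (𝟙 B) σ f u (by rw [Category.id_comp, h])]
  exact ev_congr _ (Category.id_comp _).symm rfl

theorem triPos_ext {B : E} {t t' : B ⟶ (tri p q).pos} (h₁ : t ≫ triπ p q = t' ≫ triπ p q)
    (h₂ : ∀ (C : E) (w : C ⟶ B) (u : C ⟶ p.dir) (h : (w ≫ t) ≫ triπ p q = u ≫ p.hom)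
      (h' : (w ≫ t') ≫ triπ p q = u ≫ p.hom), ev (w ≫ t) u h = ev (w ≫ t') u h') : t = t' := by
  have key : ∀ (s : B ⟶ (tri p q).pos) (σ : B ⟶ p.pos) (hs : s ≫ triπ p q = σ),
      s = triPos σ (ev (pullback.fst σ p.hom ≫ s) (pullback.snd σ p.hom)
        (by rw [Category.assoc, hs, pullback.condition])) := by
    intro s σ hs
    have e := map_piEval (X := Over.mk σ) (Over.homMk s hs : Over.mk σ ⟶ piOver p q)
    have e2 : (piEquiv p q (Over.mk σ)).symm (Over.homMk s hs : Over.mk σ ⟶ piOver p q) =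
        Over.homMk (V := prodOver p q)
          (prod.lift (ev (pullback.fst σ p.hom ≫ s) (pullback.snd σ p.hom)
            (by rw [Category.assoc, hs, pullback.condition])) (pullback.snd σ p.hom) :
            pullback σ p.hom ⟶ q.pos ⨯ p.dir) (prod.lift_snd _ _) := by
      ext1
      apply prod.hom_ext
      · refine e.symm.trans ?_
        exact (prod.lift_fst _ _).symm
      · refine (Over.w ((piEquiv p q (Over.mk σ)).symm
          (Over.homMk s hs : Over.mk σ ⟶ piOver p q))).trans ?_
        exact (prod.lift_snd _ _).symm
    unfold triPos
    rw [← e2, Equiv.apply_symm_apply]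
    rfl
  rw [key t _ rfl, key t' _ h₁.symm]
  congr 1
  exact h₂ _ _ _ _ _

end Tri

section Elements

@[simp] theorem comp_ev_assoc {B C Z : E} (w : C ⟶ B) (t : B ⟶ (tri p q).pos) (u : B ⟶ p.dir)
    (h : t ≫ triπ p q = u ≫ p.hom) (k : q.pos ⟶ Z) :
    w ≫ ev t u h ≫ k = ev (w ≫ t) (w ≫ u) (by simp [h]) ≫ k := by
  rw [← Category.assoc, comp_ev]

@[simp] theorem triPos_π_assoc {B Z : E} (σ : B ⟶ p.pos) (f : pullback σ p.hom ⟶ q.pos)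
    (k : p.pos ⟶ Z) : triPos σ f ≫ triπ p q ≫ k = σ ≫ k := by
  rw [← Category.assoc, triPos_π]

@[simp] theorem triDir_hom_assoc {B Z : E} (t : B ⟶ (tri p q).pos) (u : B ⟶ p.dir)
    (v : B ⟶ q.dir) (h : t ≫ triπ p q = u ≫ p.hom) (h' : ev t u h = v ≫ q.hom)
    (k : (tri p q).pos ⟶ Z) : triDir t u v h h' ≫ triHom p q ≫ k = t ≫ k := by
  rw [← Category.assoc, triDir_hom]

@[simp] theorem triDir_U_assoc {B Z : E} (t : B ⟶ (tri p q).pos) (u : B ⟶ p.dir)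
    (v : B ⟶ q.dir) (h : t ≫ triπ p q = u ≫ p.hom) (h' : ev t u h = v ≫ q.hom)
    (k : p.dir ⟶ Z) : triDir t u v h h' ≫ triU p q ≫ k = u ≫ k := by
  rw [← Category.assoc, triDir_U]

@[simp] theorem triDir_V_assoc {B Z : E} (t : B ⟶ (tri p q).pos) (u : B ⟶ p.dir)
    (v : B ⟶ q.dir) (h : t ≫ triπ p q = u ≫ p.hom) (h' : ev t u h = v ≫ q.hom)
    (k : q.dir ⟶ Z) : triDir t u v h h' ≫ triV p q ≫ k = v ≫ k := by
  rw [← Category.assoc, triDir_V]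

theorem cond_U {B : E} {t : B ⟶ (tri p q).pos} {d : B ⟶ (tri p q).dir} (h : t = d ≫ triHom p q) :
    t ≫ triπ p q = (d ≫ triU p q) ≫ p.hom := by
  rw [h, Category.assoc, ← triU_hom, Category.assoc]

theorem cond_V {B : E} {t : B ⟶ (tri p q).pos} {d : B ⟶ (tri p q).dir} (h : t = d ≫ triHom p q) :
    ev t (d ≫ triU p q) (cond_U h) = (d ≫ triV p q) ≫ q.hom := by
  subst h
  rw [Category.assoc, triV_hom, comp_ev]

attribute [simp] triPos_π triDir_hom triDir_U triDir_V comp_ev comp_triDir ev_triPos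

end Elements

section Map

variable {p' q' : Poly E}

/-- The action of the composition product of two morphisms on generalized positions. -/
def triMapPos (φ : p ⟶ p') (ψ : q ⟶ q') {B : E} (t : B ⟶ (tri p q).pos) :
    B ⟶ (tri p' q').pos :=
  triPos (t ≫ triπ p q ≫ Hom.pos φ)
    (ev (pullback.fst (t ≫ triπ p q ≫ Hom.pos φ) p'.hom ≫ t)
      (Hom.app φ (pullback.fst (t ≫ triπ p q ≫ Hom.pos φ) p'.hom ≫ t ≫ triπ p q)
        (pullback.snd (t ≫ triπ p q ≫ Hom.pos φ) p'.hom)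
        (by rw [← pullback.condition]; simp))
      (by simp) ≫ Hom.pos ψ)

@[simp] theorem triMapPos_π (φ : p ⟶ p') (ψ : q ⟶ q') {B : E} (t : B ⟶ (tri p q).pos) :
    triMapPos φ ψ t ≫ triπ p' q' = t ≫ triπ p q ≫ Hom.pos φ := by
  simp [triMapPos]

@[simp] theorem triMapPos_π_assoc (φ : p ⟶ p') (ψ : q ⟶ q') {B Z : E} (t : B ⟶ (tri p q).pos)
    (k : p'.pos ⟶ Z) :
    triMapPos φ ψ t ≫ triπ p' q' ≫ k = t ≫ triπ p q ≫ Hom.pos φ ≫ k := by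
  simp [triMapPos]

@[simp] theorem ev_triMapPos (φ : p ⟶ p') (ψ : q ⟶ q') {B : E} (t : B ⟶ (tri p q).pos)
    (u : B ⟶ p'.dir) (h : triMapPos φ ψ t ≫ triπ p' q' = u ≫ p'.hom) :
    ev (triMapPos φ ψ t) u h =
      ev t (Hom.app φ (t ≫ triπ p q) u (by simpa using h)) (by simp) ≫ Hom.pos ψ := by
  simp [triMapPos]

@[simp] theorem comp_triMapPos (φ : p ⟶ p') (ψ : q ⟶ q') {B C : E} (w : C ⟶ B)
    (t : B ⟶ (tri p q).pos) : w ≫ triMapPos φ ψ t = triMapPos φ ψ (w ≫ t) := by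
  apply triPos_ext
  · simp
  · intro D x u h h'
    rw [ev_congr h (Category.assoc _ _ _).symm rfl]
    refine (ev_comp_triPos _ _ _ _ _).trans (Eq.trans ?_ (ev_comp_triPos _ _ _ _ _).symm)
    simp

/-- The composition product of two morphisms. -/
def triMap (φ : p ⟶ p') (ψ : q ⟶ q') : tri p q ⟶ tri p' q' :=
  Hom.ofElements (triMapPos φ ψ (𝟙 _))
    (fun B t d h => triDir t
      (Hom.app φ (t ≫ triπ p q) (d ≫ triU p' q')
        (by rw [← cond_U h]; simp))
      (Hom.app ψ (ev t (Hom.app φ (t ≫ triπ p q) (d ≫ triU p' q')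
        (by rw [← cond_U h]; simp)) (by simp)) (d ≫ triV p' q')
        (by rw [← cond_V h]; simp))
      (by simp) (by simp))
    (fun B t d h => by simp)

@[simp] theorem comp_triMap_pos (φ : p ⟶ p') (ψ : q ⟶ q') {B : E} (t : B ⟶ (tri p q).pos) :
    t ≫ Hom.pos (triMap φ ψ) = triMapPos φ ψ t := by
  simp [triMap, Hom.ofElements]

@[simp] theorem comp_triMap_pos_assoc (φ : p ⟶ p') (ψ : q ⟶ q') {B Z : E}
    (t : B ⟶ (tri p q).pos) (k : (tri p' q').pos ⟶ Z) :
    t ≫ Hom.pos (triMap φ ψ) ≫ k = triMapPos φ ψ t ≫ k := by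
  rw [← Category.assoc, comp_triMap_pos]

@[simp] theorem triMap_app (φ : p ⟶ p') (ψ : q ⟶ q') {B : E} (t : B ⟶ (tri p q).pos)
    (d : B ⟶ (tri p' q').dir) (h : t ≫ Hom.pos (triMap φ ψ) = d ≫ triHom p' q') :
    Hom.app (triMap φ ψ) t d h = triDir t
      (Hom.app φ (t ≫ triπ p q) (d ≫ triU p' q')
        (by rw [← cond_U h]; simp))
      (Hom.app ψ (ev t (Hom.app φ (t ≫ triπ p q) (d ≫ triU p' q')
        (by rw [← cond_U h]; simp)) (by simp)) (d ≫ triV p' q')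
        (by rw [← cond_V h]; simp))
      (by simp) (by simp) := by
  exact Hom.ofElements_app _ _ _ (by intros; simp) t d h

theorem tri_hom_ext {s : Poly E} {φ ψ : s ⟶ p}
    (h₁ : ∀ (B : E) (x : B ⟶ s.pos), x ≫ Hom.pos φ = x ≫ Hom.pos ψ)
    (h₂ : ∀ (B : E) (x : B ⟶ s.pos) (y : B ⟶ p.dir) (h : x ≫ Hom.pos φ = y ≫ p.hom)
      (h' : x ≫ Hom.pos ψ = y ≫ p.hom), Hom.app φ x y h = Hom.app ψ x y h') : φ = ψ :=
  hom_ext (by simpa using h₁ _ (𝟙 _)) h₂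

theorem triMap_id (p q : Poly E) : triMap (𝟙 p) (𝟙 q) = 𝟙 (tri p q) := by
  apply tri_hom_ext
  · intro B x
    apply triPos_ext
    · simp
    · intro C w u h h'
      simp
  · intro B x y h h'
    apply triDir_ext
    · simp at h'
      simp [h']
    · simp
    · simp

theorem triMap_comp {p'' q'' : Poly E} (φ : p ⟶ p') (ψ : q ⟶ q') (φ' : p' ⟶ p'') (ψ' : q' ⟶ q'') :
    triMap φ ψ ≫ triMap φ' ψ' = triMap (φ ≫ φ') (ψ ≫ ψ') := by
  apply tri_hom_ext
  · intro B x
    apply triPos_ext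
    · simp
    · intro C w u h h'
      simp
  · intro B x y h h'
    apply triDir_ext
    · simp
    · simp
    · simp

end Map

section Associator

theorem comp_triPos_eq {B C : E} (w : C ⟶ B) (σ : B ⟶ p.pos) (f : pullback σ p.hom ⟶ q.pos)
    (σ' : C ⟶ p.pos) (f' : pullback σ' p.hom ⟶ q.pos) (hσ : w ≫ σ = σ')
    (hf : ∀ (D : E) (x : D ⟶ C) (u : D ⟶ p.dir) (h : (x ≫ w) ≫ σ = u ≫ p.hom)
      (h' : x ≫ σ' = u ≫ p.hom), pullback.lift (x ≫ w) u h ≫ f = pullback.lift x u h' ≫ f') :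
    w ≫ triPos σ f = triPos σ' f' := by
  apply triPos_ext
  · simpa
  · intro D x u h h'
    rw [ev_congr h (Category.assoc _ _ _).symm rfl, ev_comp_triPos, ev_comp_triPos]
    exact hf _ _ _ _ _

theorem triDir_eta {B : E} {t : B ⟶ (tri p q).pos} {d : B ⟶ (tri p q).dir}
    (h : t = d ≫ triHom p q) (h₁ : t ≫ triπ p q = (d ≫ triU p q) ≫ p.hom)
    (h₂ : ev t (d ≫ triU p q) h₁ = (d ≫ triV p q) ≫ q.hom) :
    triDir t (d ≫ triU p q) (d ≫ triV p q) h₁ h₂ = d :=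
  triDir_ext (by simpa using h) (by simp) (by simp)

/-- The value at a direction `u` of `p` of the position of `p ◁ (q ◁ r)` that corresponds to the
position `s` of `(p ◁ q) ◁ r`. -/
def assocInner {B : E} (s : B ⟶ (tri (tri p q) r).pos) (u : B ⟶ p.dir)
    (h : s ≫ triπ (tri p q) r ≫ triπ p q = u ≫ p.hom) : B ⟶ (tri q r).pos :=
  triPos (ev (s ≫ triπ (tri p q) r) u (by simpa using h))
    (ev (pullback.fst (ev (s ≫ triπ (tri p q) r) u (by simpa using h)) q.hom ≫ s)
      (triDir (pullback.fst (ev (s ≫ triπ (tri p q) r) u (by simpa using h)) q.hom ≫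
          s ≫ triπ (tri p q) r)
        (pullback.fst (ev (s ≫ triπ (tri p q) r) u (by simpa using h)) q.hom ≫ u)
        (pullback.snd (ev (s ≫ triπ (tri p q) r) u (by simpa using h)) q.hom)
        (by simp [h])
        (by rw [← pullback.condition, comp_ev]))
      (by simp))

@[simp] theorem assocInner_π {B : E} (s : B ⟶ (tri (tri p q) r).pos) (u : B ⟶ p.dir)
    (h : s ≫ triπ (tri p q) r ≫ triπ p q = u ≫ p.hom) :
    assocInner s u h ≫ triπ q r = ev (s ≫ triπ (tri p q) r) u (by simpa using h) :=
  triPos_π _ _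

@[simp] theorem assocInner_π_assoc {B Z : E} (s : B ⟶ (tri (tri p q) r).pos) (u : B ⟶ p.dir)
    (h : s ≫ triπ (tri p q) r ≫ triπ p q = u ≫ p.hom) (k : q.pos ⟶ Z) :
    assocInner s u h ≫ triπ q r ≫ k = ev (s ≫ triπ (tri p q) r) u (by simpa using h) ≫ k :=
  triPos_π_assoc _ _ _

@[simp] theorem comp_assocInner {B C : E} (w : C ⟶ B) (s : B ⟶ (tri (tri p q) r).pos)
    (u : B ⟶ p.dir) (h : s ≫ triπ (tri p q) r ≫ triπ p q = u ≫ p.hom) :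
    w ≫ assocInner s u h = assocInner (w ≫ s) (w ≫ u) (by simp [h]) :=
  comp_triPos_eq _ _ _ _ _ (by simp) (by intros; simp)

@[simp] theorem ev_assocInner {B : E} (s : B ⟶ (tri (tri p q) r).pos) (u : B ⟶ p.dir)
    (h : s ≫ triπ (tri p q) r ≫ triπ p q = u ≫ p.hom) (v : B ⟶ q.dir)
    (h' : assocInner s u h ≫ triπ q r = v ≫ q.hom) :
    ev (assocInner s u h) v h' = ev s (triDir (s ≫ triπ (tri p q) r) u v (by simpa using h)
      (by rw [← h', assocInner_π])) (by simp) := by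
  simp [assocInner]

/-- The associator on generalized positions. -/
def assocPos {B : E} (s : B ⟶ (tri (tri p q) r).pos) : B ⟶ (tri p (tri q r)).pos :=
  triPos (s ≫ triπ (tri p q) r ≫ triπ p q)
    (assocInner (pullback.fst (s ≫ triπ (tri p q) r ≫ triπ p q) p.hom ≫ s)
      (pullback.snd (s ≫ triπ (tri p q) r ≫ triπ p q) p.hom)
      (by rw [← pullback.condition]; simp))

@[simp] theorem assocPos_π {B : E} (s : B ⟶ (tri (tri p q) r).pos) :
    assocPos s ≫ triπ p (tri q r) = s ≫ triπ (tri p q) r ≫ triπ p q :=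
  triPos_π _ _

@[simp] theorem assocPos_π_assoc {B Z : E} (s : B ⟶ (tri (tri p q) r).pos) (k : p.pos ⟶ Z) :
    assocPos s ≫ triπ p (tri q r) ≫ k = s ≫ triπ (tri p q) r ≫ triπ p q ≫ k := by
  simp [assocPos]

@[simp] theorem comp_assocPos {B C : E} (w : C ⟶ B) (s : B ⟶ (tri (tri p q) r).pos) :
    w ≫ assocPos s = assocPos (w ≫ s) :=
  comp_triPos_eq _ _ _ _ _ (by simp) (by intros; simp)

@[simp] theorem ev_assocPos {B : E} (s : B ⟶ (tri (tri p q) r).pos) (u : B ⟶ p.dir)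
    (h : assocPos s ≫ triπ p (tri q r) = u ≫ p.hom) :
    ev (assocPos s) u h = assocInner s u (by rw [← h, assocPos_π]) := by
  simp [assocPos]

/-- The associator. -/
def assocHom (p q r : Poly E) : tri (tri p q) r ⟶ tri p (tri q r) :=
  Hom.ofElements (assocPos (𝟙 _))
    (fun B s d h => triDir s
      (triDir (s ≫ triπ (tri p q) r) (d ≫ triU p (tri q r)) (d ≫ triV p (tri q r) ≫ triU q r)
        (by rw [← cond_U h]; simp)
        (by rw [← Category.assoc d, ← cond_U (cond_V h)]; simp))
      (d ≫ triV p (tri q r) ≫ triV q r)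
      (by simp)
      (by rw [← Category.assoc d (triV p (tri q r)) (triV q r), ← cond_V (cond_V h)]; simp))
    (fun B s d h => by simp)

@[simp] theorem comp_assocHom_pos {B : E} (s : B ⟶ (tri (tri p q) r).pos) :
    s ≫ Hom.pos (assocHom p q r) = assocPos s := by
  simp [assocHom, Hom.ofElements]

@[simp] theorem comp_assocHom_pos_assoc {B Z : E} (s : B ⟶ (tri (tri p q) r).pos)
    (k : (tri p (tri q r)).pos ⟶ Z) :
    s ≫ Hom.pos (assocHom p q r) ≫ k = assocPos s ≫ k := by
  rw [← Category.assoc, comp_assocHom_pos]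

@[simp] theorem assocHom_app {B : E} (s : B ⟶ (tri (tri p q) r).pos)
    (d : B ⟶ (tri p (tri q r)).dir)
    (h : s ≫ Hom.pos (assocHom p q r) = d ≫ triHom p (tri q r)) :
    Hom.app (assocHom p q r) s d h = triDir s
      (triDir (s ≫ triπ (tri p q) r) (d ≫ triU p (tri q r)) (d ≫ triV p (tri q r) ≫ triU q r)
        (by rw [← cond_U h]; simp)
        (by rw [← Category.assoc d, ← cond_U (cond_V h)]; simp))
      (d ≫ triV p (tri q r) ≫ triV q r)
      (by simp)
      (by rw [← Category.assoc d (triV p (tri q r)) (triV q r), ← cond_V (cond_V h)]; simp) :=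
  Hom.ofElements_app _ _ _ (by intros; simp) s d h

/-- The position of `p ◁ q` underlying a position of `p ◁ (q ◁ r)`. -/
def assocInvBase {B : E} (s : B ⟶ (tri p (tri q r)).pos) : B ⟶ (tri p q).pos :=
  triPos (s ≫ triπ p (tri q r))
    (ev (pullback.fst (s ≫ triπ p (tri q r)) p.hom ≫ s)
      (pullback.snd (s ≫ triπ p (tri q r)) p.hom)
      (by rw [Category.assoc, pullback.condition]) ≫ triπ q r)

@[simp] theorem assocInvBase_π {B : E} (s : B ⟶ (tri p (tri q r)).pos) :
    assocInvBase s ≫ triπ p q = s ≫ triπ p (tri q r) :=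
  triPos_π _ _

@[simp] theorem assocInvBase_π_assoc {B Z : E} (s : B ⟶ (tri p (tri q r)).pos) (k : p.pos ⟶ Z) :
    assocInvBase s ≫ triπ p q ≫ k = s ≫ triπ p (tri q r) ≫ k := by
  simp [assocInvBase]

@[simp] theorem comp_assocInvBase {B C : E} (w : C ⟶ B) (s : B ⟶ (tri p (tri q r)).pos) :
    w ≫ assocInvBase s = assocInvBase (w ≫ s) :=
  comp_triPos_eq _ _ _ _ _ (by simp) (by intros; simp)

@[simp] theorem ev_assocInvBase {B : E} (s : B ⟶ (tri p (tri q r)).pos) (u : B ⟶ p.dir)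
    (h : assocInvBase s ≫ triπ p q = u ≫ p.hom) :
    ev (assocInvBase s) u h = ev s u (by rw [← h, assocInvBase_π]) ≫ triπ q r := by
  simp [assocInvBase]

/-- The value at a direction `d` of `p ◁ q` of the position of `(p ◁ q) ◁ r` that corresponds to
the position `s` of `p ◁ (q ◁ r)`. -/
def assocInvInner {B : E} (s : B ⟶ (tri p (tri q r)).pos) (d : B ⟶ (tri p q).dir)
    (h : assocInvBase s = d ≫ triHom p q) : B ⟶ r.pos :=
  ev (ev s (d ≫ triU p q) (by rw [← cond_U h]; simp)) (d ≫ triV p q)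
    (by rw [← cond_V h]; simp)

@[simp] theorem comp_assocInvInner {B C : E} (w : C ⟶ B) (s : B ⟶ (tri p (tri q r)).pos)
    (d : B ⟶ (tri p q).dir) (h : assocInvBase s = d ≫ triHom p q) :
    w ≫ assocInvInner s d h = assocInvInner (w ≫ s) (w ≫ d)
      (by rw [← comp_assocInvBase, h, Category.assoc]) := by
  simp [assocInvInner]

/-- The inverse of the associator on generalized positions. -/
def assocInvPos {B : E} (s : B ⟶ (tri p (tri q r)).pos) : B ⟶ (tri (tri p q) r).pos :=
  triPos (p := tri p q) (assocInvBase s)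
    (assocInvInner (pullback.fst (assocInvBase s) (triHom p q) ≫ s)
      (pullback.snd (assocInvBase s) (triHom p q))
      (by rw [← comp_assocInvBase, pullback.condition]))

@[simp] theorem assocInvPos_π {B : E} (s : B ⟶ (tri p (tri q r)).pos) :
    assocInvPos s ≫ triπ (tri p q) r = assocInvBase s :=
  triPos_π _ _

@[simp] theorem assocInvPos_π_assoc {B Z : E} (s : B ⟶ (tri p (tri q r)).pos)
    (k : (tri p q).pos ⟶ Z) :
    assocInvPos s ≫ triπ (tri p q) r ≫ k = assocInvBase s ≫ k :=
  triPos_π_assoc _ _ _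

@[simp] theorem comp_assocInvPos {B C : E} (w : C ⟶ B) (s : B ⟶ (tri p (tri q r)).pos) :
    w ≫ assocInvPos s = assocInvPos (w ≫ s) :=
  comp_triPos_eq _ _ _ _ _ (by simp) (by intros; simp)

@[simp] theorem ev_assocInvPos {B : E} (s : B ⟶ (tri p (tri q r)).pos) (d : B ⟶ (tri p q).dir)
    (h : assocInvPos s ≫ triπ (tri p q) r = d ≫ triHom p q) :
    ev (assocInvPos s) d h = ev (ev s (d ≫ triU p q)
        (by rw [← cond_U ((assocInvPos_π s).symm.trans h)]; simp)) (d ≫ triV p q)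
      (by rw [← cond_V ((assocInvPos_π s).symm.trans h)]; simp) := by
  simp [assocInvPos, assocInvInner]

/-- The inverse of the associator. -/
def assocInv (p q r : Poly E) : tri p (tri q r) ⟶ tri (tri p q) r :=
  Hom.ofElements (assocInvPos (𝟙 _))
    (fun B s d h => triDir s (d ≫ triU (tri p q) r ≫ triU p q)
      (triDir (ev s (d ≫ triU (tri p q) r ≫ triU p q)
          (by rw [← Category.assoc d, ← cond_U (cond_U h)]; simp))
        (d ≫ triU (tri p q) r ≫ triV p q) (d ≫ triV (tri p q) r)
        (by rw [← Category.assoc d _ (triV p q), ← cond_V (cond_U h)]; simp)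
        (by rw [← cond_V h]; simp))
      (by rw [← Category.assoc d, ← cond_U (cond_U h)]; simp)
      (by simp))
    (fun B s d h => by simp)

@[simp] theorem comp_assocInv_pos {B : E} (s : B ⟶ (tri p (tri q r)).pos) :
    s ≫ Hom.pos (assocInv p q r) = assocInvPos s := by
  simp [assocInv, Hom.ofElements]

@[simp] theorem comp_assocInv_pos_assoc {B Z : E} (s : B ⟶ (tri p (tri q r)).pos)
    (k : (tri (tri p q) r).pos ⟶ Z) :
    s ≫ Hom.pos (assocInv p q r) ≫ k = assocInvPos s ≫ k := by
  rw [← Category.assoc, comp_assocInv_pos]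

@[simp] theorem assocInv_app {B : E} (s : B ⟶ (tri p (tri q r)).pos)
    (d : B ⟶ (tri (tri p q) r).dir)
    (h : s ≫ Hom.pos (assocInv p q r) = d ≫ triHom (tri p q) r) :
    Hom.app (assocInv p q r) s d h = triDir s (d ≫ triU (tri p q) r ≫ triU p q)
      (triDir (ev s (d ≫ triU (tri p q) r ≫ triU p q)
          (by rw [← Category.assoc d, ← cond_U (cond_U h)]; simp))
        (d ≫ triU (tri p q) r ≫ triV p q) (d ≫ triV (tri p q) r)
        (by rw [← Category.assoc d _ (triV p q), ← cond_V (cond_U h)]; simp)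
        (by rw [← cond_V h]; simp))
      (by rw [← Category.assoc d, ← cond_U (cond_U h)]; simp)
      (by simp) :=
  Hom.ofElements_app _ _ _ (by intros; simp) s d h

/-- The associativity isomorphism of the composition product. -/
def assocIso (p q r : Poly E) : tri (tri p q) r ≅ tri p (tri q r) where
  hom := assocHom p q r
  inv := assocInv p q r
  hom_inv_id := by
    apply tri_hom_ext
    · intro B x
      apply triPos_ext
      · apply triPos_ext
        · simp
        · intro C w u h h'
          simp
      · intro C w u h h'
        simp only [id_pos, Category.comp_id] at h'
        simp
        exact ev_congr _ rfl (triDir_eta ((Category.assoc _ _ _).symm.trans h') _ _)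
    · intro B x y h h'
      simp only [id_pos, Category.comp_id] at h'
      subst h'
      apply triDir_ext
      · simp
      · apply triDir_ext
        · simp only [comp_app, assocHom_app, assocInv_app, triDir_U, triDir_hom, id_app]
          exact cond_U rfl
        · simp
        · simp
      · simp
  inv_hom_id := by
    apply tri_hom_ext
    · intro B x
      apply triPos_ext
      · simp
      · intro C w u h h'
        apply triPos_ext
        · simp
        · intro D z v k k'
          simp
    · intro B x y h h'
      simp only [id_pos, Category.comp_id] at h'
      subst h'
      apply triDir_ext
      · simp
      · simp
      · apply triDir_ext
        · simp only [comp_app, assocHom_app, assocInv_app, triDir_V, triDir_hom, id_app]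
          refine Eq.trans (ev_congr _ rfl ?_) (cond_V (p := p) (q := tri q r) rfl)
          simp
        · simp
        · simp

end Associator

section Unitors

/-- The unique generalized element of `1`. -/
def one (B : E) : B ⟶ (y : Poly E).pos := terminal.from B

theorem one_ext {B : E} (f g : B ⟶ (y : Poly E).pos) : f = g :=
  terminal.hom_ext f g

theorem one_ext' {B : E} (f g : B ⟶ (y : Poly E).dir) : f = g :=
  terminal.hom_ext f g

/-- The unique generalized direction of the identity polynomial. -/
def oneDir (B : E) : B ⟶ (y : Poly E).dir := terminal.from B

@[simp] theorem comp_one {B C : E} (w : C ⟶ B) : w ≫ one B = one C := one_ext _ _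

@[simp] theorem comp_oneDir {B C : E} (w : C ⟶ B) : w ≫ oneDir B = oneDir C := one_ext' _ _

/-- The left unitor on generalized positions. -/
def leftPos {B : E} (t : B ⟶ (tri y p).pos) : B ⟶ p.pos := ev t (oneDir B) (one_ext _ _)

@[simp] theorem comp_leftPos {B C : E} (w : C ⟶ B) (t : B ⟶ (tri y p).pos) :
    w ≫ leftPos t = leftPos (w ≫ t) := by
  simp [leftPos]

theorem ev_one {B : E} (t : B ⟶ (tri y p).pos) (u : B ⟶ (y : Poly E).dir)
    (h : t ≫ triπ y p = u ≫ (y : Poly E).hom) : ev t u h = leftPos t :=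
  ev_congr _ rfl (one_ext' _ _)

/-- The inverse of the left unitor on generalized positions. -/
def leftInvPos {B : E} (x : B ⟶ p.pos) : B ⟶ (tri y p).pos :=
  triPos (one B) (pullback.fst (one B) (y : Poly E).hom ≫ x)

@[simp] theorem comp_leftInvPos {B C : E} (w : C ⟶ B) (x : B ⟶ p.pos) :
    w ≫ leftInvPos x = leftInvPos (w ≫ x) :=
  comp_triPos_eq _ _ _ _ _ (one_ext _ _) (by intros; simp)

@[simp] theorem leftPos_inv {B : E} (x : B ⟶ p.pos) : leftPos (leftInvPos x) = x := by
  simp [leftPos, leftInvPos]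

/-- The left unitor. -/
def leftHom (p : Poly E) : tri y p ⟶ p :=
  Hom.ofElements (leftPos (𝟙 _))
    (fun B t z h => triDir t (oneDir B) z (one_ext _ _)
      (by rw [ev_one, ← h, comp_leftPos, Category.comp_id]))
    (fun B t z h => by simp)

@[simp] theorem comp_leftHom_pos {B : E} (t : B ⟶ (tri y p).pos) :
    t ≫ Hom.pos (leftHom p) = leftPos t := by
  simp [leftHom, Hom.ofElements]

@[simp] theorem comp_leftHom_pos_assoc {B Z : E} (t : B ⟶ (tri y p).pos) (k : p.pos ⟶ Z) :
    t ≫ Hom.pos (leftHom p) ≫ k = leftPos t ≫ k := by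
  rw [← Category.assoc, comp_leftHom_pos]

@[simp] theorem leftHom_app {B : E} (t : B ⟶ (tri y p).pos) (z : B ⟶ p.dir)
    (h : t ≫ Hom.pos (leftHom p) = z ≫ p.hom) :
    Hom.app (leftHom p) t z h = triDir t (oneDir B) z (one_ext _ _)
      (by rw [ev_one, ← h, comp_leftHom_pos]) :=
  Hom.ofElements_app _ _ _ (by intros; simp) t z h

/-- The inverse of the left unitor. -/
def leftInv (p : Poly E) : p ⟶ tri y p :=
  Hom.ofElements (leftInvPos (𝟙 _))
    (fun B x d h => d ≫ triV y p)
    (fun B x d h => by rw [← cond_V h, ev_one]; simp)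

@[simp] theorem comp_leftInv_pos {B : E} (x : B ⟶ p.pos) :
    x ≫ Hom.pos (leftInv p) = leftInvPos x := by
  simp [leftInv, Hom.ofElements]

@[simp] theorem comp_leftInv_pos_assoc {B Z : E} (x : B ⟶ p.pos) (k : (tri y p).pos ⟶ Z) :
    x ≫ Hom.pos (leftInv p) ≫ k = leftInvPos x ≫ k := by
  rw [← Category.assoc, comp_leftInv_pos]

@[simp] theorem leftInv_app {B : E} (x : B ⟶ p.pos) (d : B ⟶ (tri y p).dir)
    (h : x ≫ Hom.pos (leftInv p) = d ≫ triHom y p) :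
    Hom.app (leftInv p) x d h = d ≫ triV y p :=
  Hom.ofElements_app _ _ _ (by intros; simp) x d h

/-- The left unit isomorphism of the composition product. -/
def leftIso (p : Poly E) : tri y p ≅ p where
  hom := leftHom p
  inv := leftInv p
  hom_inv_id := by
    apply tri_hom_ext
    · intro B x
      apply triPos_ext
      · exact one_ext _ _
      · intro C w u h h'
        simp [ev_one]
    · intro B x z h h'
      simp only [id_pos, Category.comp_id] at h'
      subst h'
      apply triDir_ext
      · simp
      · exact one_ext' _ _
      · simp
  inv_hom_id := by
    apply tri_hom_ext
    · intro B x
      simp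
    · intro B x z h h'
      simp

/-- The inverse of the right unitor on generalized positions. -/
def rightInvPos {B : E} (x : B ⟶ p.pos) : B ⟶ (tri p y).pos :=
  triPos x (one _)

@[simp] theorem comp_rightInvPos {B C : E} (w : C ⟶ B) (x : B ⟶ p.pos) :
    w ≫ rightInvPos x = rightInvPos (w ≫ x) :=
  comp_triPos_eq _ _ _ _ _ rfl (by intros; exact one_ext _ _)

@[simp] theorem rightInvPos_π {B : E} (x : B ⟶ p.pos) : rightInvPos x ≫ triπ p y = x :=
  triPos_π _ _

@[simp] theorem rightInvPos_π_assoc {B Z : E} (x : B ⟶ p.pos) (k : p.pos ⟶ Z) :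
    rightInvPos x ≫ triπ p y ≫ k = x ≫ k :=
  triPos_π_assoc _ _ _

/-- The right unitor. -/
def rightHom (p : Poly E) : tri p y ⟶ p :=
  Hom.ofElements (triπ p y)
    (fun B t u h => triDir t u (oneDir B) h (one_ext _ _))
    (fun B t z h => by simp)

@[simp] theorem rightHom_pos : Hom.pos (rightHom p) = triπ p y := rfl

@[simp] theorem rightHom_app {B : E} (t : B ⟶ (tri p y).pos) (u : B ⟶ p.dir)
    (h : t ≫ Hom.pos (rightHom p) = u ≫ p.hom) :
    Hom.app (rightHom p) t u h = triDir t u (oneDir B) (by rw [← h, rightHom_pos])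
      (one_ext _ _) :=
  Hom.ofElements_app _ _ _
    (fun B _ w x k h => (comp_triDir w x k (oneDir B) h (one_ext _ _)).trans
      (by simp only [comp_oneDir])) t u h

/-- The inverse of the right unitor. -/
def rightInv (p : Poly E) : p ⟶ tri p y :=
  Hom.ofElements (rightInvPos (𝟙 _))
    (fun B x d h => d ≫ triU p y)
    (fun B x d h => by rw [← cond_U h]; simp)

@[simp] theorem comp_rightInv_pos {B : E} (x : B ⟶ p.pos) :
    x ≫ Hom.pos (rightInv p) = rightInvPos x := by
  simp [rightInv, Hom.ofElements]

@[simp] theorem comp_rightInv_pos_assoc {B Z : E} (x : B ⟶ p.pos) (k : (tri p y).pos ⟶ Z) :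
    x ≫ Hom.pos (rightInv p) ≫ k = rightInvPos x ≫ k := by
  rw [← Category.assoc, comp_rightInv_pos]

@[simp] theorem rightInv_app {B : E} (x : B ⟶ p.pos) (d : B ⟶ (tri p y).dir)
    (h : x ≫ Hom.pos (rightInv p) = d ≫ triHom p y) :
    Hom.app (rightInv p) x d h = d ≫ triU p y :=
  Hom.ofElements_app _ _ _ (by intros; simp) x d h

/-- The right unit isomorphism of the composition product. -/
def rightIso (p : Poly E) : tri p y ≅ p where
  hom := rightHom p
  inv := rightInv p
  hom_inv_id := by
    apply tri_hom_ext
    · intro B x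
      apply triPos_ext
      · simp
      · intro C w u h h'
        exact one_ext _ _
    · intro B x z h h'
      simp only [id_pos, Category.comp_id] at h'
      subst h'
      apply triDir_ext
      · simp
      · simp
      · exact one_ext' _ _
  inv_hom_id := by
    apply tri_hom_ext
    · intro B x
      simp
    · intro B x z h h'
      simp

end Unitors

section Monoidal

variable {p' q' r' s : Poly E}

theorem assoc_naturality (φ : p ⟶ p') (ψ : q ⟶ q') (χ : r ⟶ r') :
    triMap (triMap φ ψ) χ ≫ assocHom p' q' r' = assocHom p q r ≫ triMap φ (triMap ψ χ) := by
  apply tri_hom_ext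
  · intro B x
    apply triPos_ext
    · simp
    · intro C w u h h'
      apply triPos_ext
      · simp
      · intro D z v k k'
        simp
  · intro B x d h h'
    apply triDir_ext
    · simp
    · apply triDir_ext
      · simp
      · simp
      · simp
    · simp

theorem left_naturality (φ : p ⟶ p') :
    triMap (𝟙 y) φ ≫ leftHom p' = leftHom p ≫ φ := by
  apply tri_hom_ext
  · intro B x
    simp [leftPos]
  · intro B x d h h'
    apply triDir_ext
    · simp
    · exact one_ext' _ _
    · simp [leftPos]

theorem right_naturality (φ : p ⟶ p') :
    triMap φ (𝟙 y) ≫ rightHom p' = rightHom p ≫ φ := by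
  apply tri_hom_ext
  · intro B x
    simp
  · intro B x d h h'
    apply triDir_ext
    · simp
    · simp
    · exact one_ext' _ _

theorem triMap_app_U (φ : p ⟶ p') (ψ : q ⟶ q') {B : E} (t : B ⟶ (tri p q).pos)
    (d : B ⟶ (tri p' q').dir) (h : t ≫ Hom.pos (triMap φ ψ) = d ≫ triHom p' q') :
    Hom.app (triMap φ ψ) t d h ≫ triU p q =
      Hom.app φ (t ≫ triπ p q) (d ≫ triU p' q') (by rw [← cond_U h]; simp) := by
  rw [triMap_app, triDir_U]

theorem triMap_app_V_id (φ : p ⟶ p') {B : E} (t : B ⟶ (tri p q).pos)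
    (d : B ⟶ (tri p' q).dir) (h : t ≫ Hom.pos (triMap φ (𝟙 q)) = d ≫ triHom p' q) :
    Hom.app (triMap φ (𝟙 q)) t d h ≫ triV p q = d ≫ triV p' q := by
  rw [triMap_app, triDir_V, id_app]

theorem triMap_app_U_id (ψ : q ⟶ q') {B : E} (t : B ⟶ (tri p q).pos)
    (d : B ⟶ (tri p q').dir) (h : t ≫ Hom.pos (triMap (𝟙 p) ψ) = d ≫ triHom p q') :
    Hom.app (triMap (𝟙 p) ψ) t d h ≫ triU p q = d ≫ triU p q' := by
  rw [triMap_app, triDir_U, id_app]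

theorem triMap_app_V (φ : p ⟶ p') (ψ : q ⟶ q') {B : E} (t : B ⟶ (tri p q).pos)
    (d : B ⟶ (tri p' q').dir) (h : t ≫ Hom.pos (triMap φ ψ) = d ≫ triHom p' q') :
    Hom.app (triMap φ ψ) t d h ≫ triV p q =
      Hom.app ψ (ev t (Hom.app φ (t ≫ triπ p q) (d ≫ triU p' q')
        (by rw [← cond_U h]; simp)) (by simp)) (d ≫ triV p' q')
        (by rw [← cond_V h]; simp) := by
  rw [triMap_app, triDir_V]

theorem assocHom_app_UU {B : E} (s : B ⟶ (tri (tri p q) r).pos)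
    (d : B ⟶ (tri p (tri q r)).dir)
    (h : s ≫ Hom.pos (assocHom p q r) = d ≫ triHom p (tri q r)) :
    Hom.app (assocHom p q r) s d h ≫ triU (tri p q) r ≫ triU p q = d ≫ triU p (tri q r) := by
  rw [assocHom_app, triDir_U_assoc, triDir_U]

theorem assocHom_app_UV {B : E} (s : B ⟶ (tri (tri p q) r).pos)
    (d : B ⟶ (tri p (tri q r)).dir)
    (h : s ≫ Hom.pos (assocHom p q r) = d ≫ triHom p (tri q r)) :
    Hom.app (assocHom p q r) s d h ≫ triU (tri p q) r ≫ triV p q =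
      d ≫ triV p (tri q r) ≫ triU q r := by
  rw [assocHom_app, triDir_U_assoc, triDir_V]

theorem assocHom_app_V {B : E} (s : B ⟶ (tri (tri p q) r).pos)
    (d : B ⟶ (tri p (tri q r)).dir)
    (h : s ≫ Hom.pos (assocHom p q r) = d ≫ triHom p (tri q r)) :
    Hom.app (assocHom p q r) s d h ≫ triV (tri p q) r = d ≫ triV p (tri q r) ≫ triV q r := by
  rw [assocHom_app, triDir_V]

theorem triU_hom_ext {B : E} {d d' : B ⟶ (tri p q).dir}
    (h₀ : d ≫ triHom p q = d' ≫ triHom p q) :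
    (d ≫ triU p q) ≫ p.hom = (d' ≫ triU p q) ≫ p.hom :=
  (cond_U h₀.symm).symm.trans (Category.assoc _ _ _) |>.trans
    (congrArg (fun k => d' ≫ k) triU_hom).symm |>.trans (Category.assoc _ _ _).symm

theorem triDir_ext_U {B : E} {d d' : B ⟶ (tri (tri p q) r).dir}
    (h₀ : d ≫ triHom (tri p q) r = d' ≫ triHom (tri p q) r)
    (h₁ : (d ≫ triU (tri p q) r) ≫ triU p q = (d' ≫ triU (tri p q) r) ≫ triU p q)
    (h₂ : (d ≫ triU (tri p q) r) ≫ triV p q = (d' ≫ triU (tri p q) r) ≫ triV p q) :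
    d ≫ triU (tri p q) r = d' ≫ triU (tri p q) r := by
  exact triDir_ext (triU_hom_ext h₀) h₁ h₂

theorem tri_pentagon_pos (p q r s : Poly E) {B : E} (x : B ⟶ (tri (tri (tri p q) r) s).pos) :
    x ≫ Hom.pos (triMap (assocHom p q r) (𝟙 s) ≫ assocHom p (tri q r) s ≫
        triMap (𝟙 p) (assocHom q r s)) =
      x ≫ Hom.pos (assocHom (tri p q) r s ≫ assocHom p q (tri r s)) := by
  apply triPos_ext
  · simp
  · intro C w u h h'
    apply triPos_ext
    · simp
    · intro D z v k k'
      apply triPos_ext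
      · simp
      · intro F a b c c'
        simp

theorem tri_pentagon_aux {B : E} (x : B ⟶ (tri (tri (tri p q) r) s).pos)
    (y₁ : B ⟶ (tri (tri p (tri q r)) s).pos) (y₂ : B ⟶ (tri p (tri (tri q r) s)).pos)
    (y₃ : B ⟶ (tri (tri p q) (tri r s)).pos) (d : B ⟶ (tri p (tri q (tri r s))).dir)
    (k₂ : y₂ ≫ Hom.pos (triMap (𝟙 p) (assocHom q r s)) = d ≫ triHom p (tri q (tri r s)))
    (k₁ : y₁ ≫ Hom.pos (assocHom p (tri q r) s) =
      Hom.app (triMap (𝟙 p) (assocHom q r s)) y₂ d k₂ ≫ triHom p (tri (tri q r) s))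
    (k₀ : x ≫ Hom.pos (triMap (assocHom p q r) (𝟙 s)) =
      Hom.app (assocHom p (tri q r) s) y₁ (Hom.app (triMap (𝟙 p) (assocHom q r s)) y₂ d k₂) k₁ ≫
        triHom (tri p (tri q r)) s)
    (k₃ : y₃ ≫ Hom.pos (assocHom p q (tri r s)) = d ≫ triHom p (tri q (tri r s)))
    (k₄ : x ≫ Hom.pos (assocHom (tri p q) r s) =
      Hom.app (assocHom p q (tri r s)) y₃ d k₃ ≫ triHom (tri p q) (tri r s)) :
    Hom.app (triMap (assocHom p q r) (𝟙 s)) x (Hom.app (assocHom p (tri q r) s) y₁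
        (Hom.app (triMap (𝟙 p) (assocHom q r s)) y₂ d k₂) k₁) k₀ =
      Hom.app (assocHom (tri p q) r s) x (Hom.app (assocHom p q (tri r s)) y₃ d k₃) k₄ := by
  have h₀ := (Hom.app_hom (triMap (assocHom p q r) (𝟙 s)) x _ k₀).trans
    (Hom.app_hom (assocHom (tri p q) r s) x _ k₄).symm
  have eU := triMap_app_U (assocHom p q r) (𝟙 s) x _ k₀
  have eV := triMap_app_V_id (assocHom p q r) x _ k₀
  generalize Hom.app (triMap (assocHom p q r) (𝟙 s)) x _ k₀ = e at h₀ eU eV ⊢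
  have fUU := assocHom_app_UU x _ k₄
  have fUV := assocHom_app_UV x _ k₄
  have fV := assocHom_app_V x _ k₄
  generalize Hom.app (assocHom (tri p q) r s) x _ k₄ = f at h₀ fUU fUV fV ⊢
  have gUU := assocHom_app_UU y₃ d k₃
  have gUV := assocHom_app_UV y₃ d k₃
  have gV := assocHom_app_V y₃ d k₃
  generalize Hom.app (assocHom p q (tri r s)) y₃ d k₃ = g at *
  have aUU := assocHom_app_UU y₁ _ k₁
  have aUV := assocHom_app_UV y₁ _ k₁
  have aV := assocHom_app_V y₁ _ k₁
  generalize Hom.app (assocHom p (tri q r) s) y₁ _ k₁ = a at *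
  have bU := triMap_app_U_id (assocHom q r s) y₂ d k₂
  have bV := triMap_app_V (𝟙 p) (assocHom q r s) y₂ d k₂
  generalize Hom.app (triMap (𝟙 p) (assocHom q r s)) y₂ d k₂ = b at *
  have mUU := (congrArg (fun k => k ≫ triU (tri p q) r ≫ triU p q) eU).trans
    (assocHom_app_UU _ _ _)
  have mUV := (congrArg (fun k => k ≫ triU (tri p q) r ≫ triV p q) eU).trans
    (assocHom_app_UV _ _ _)
  have mV := (congrArg (fun k => k ≫ triV (tri p q) r) eU).trans (assocHom_app_V _ _ _)
  have nUU := (congrArg (fun k => k ≫ triU (tri q r) s ≫ triU q r) bV).trans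
    (assocHom_app_UU _ _ _)
  have nUV := (congrArg (fun k => k ≫ triU (tri q r) s ≫ triV q r) bV).trans
    (assocHom_app_UV _ _ _)
  have nV := (congrArg (fun k => k ≫ triV (tri q r) s) bV).trans (assocHom_app_V _ _ _)
  clear eU bV
  have V : e ≫ triV (tri (tri p q) r) s = f ≫ triV (tri (tri p q) r) s := by
    rw [eV, aV, fV, ← Category.assoc g, gV]
    simpa only [Category.assoc] using nV
  have UV : (e ≫ triU (tri (tri p q) r) s) ≫ triV (tri p q) r =
      (f ≫ triU (tri (tri p q) r) s) ≫ triV (tri p q) r := by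
    rw [Category.assoc f, fUV, ← Category.assoc g, gV]
    refine mV.trans ?_
    rw [← Category.assoc, Category.assoc a, aUV]
    simpa only [Category.assoc] using nUV
  have UUV : ((e ≫ triU (tri (tri p q) r) s) ≫ triU (tri p q) r) ≫ triV p q =
      ((f ≫ triU (tri (tri p q) r) s) ≫ triU (tri p q) r) ≫ triV p q := by
    rw [Category.assoc f, fUU, Category.assoc g, gUV, Category.assoc]
    refine mUV.trans ?_
    rw [← Category.assoc, Category.assoc a, aUV]
    simpa only [Category.assoc] using nUU
  have UUU : ((e ≫ triU (tri (tri p q) r) s) ≫ triU (tri p q) r) ≫ triU p q =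
      ((f ≫ triU (tri (tri p q) r) s) ≫ triU (tri p q) r) ≫ triU p q := by
    rw [Category.assoc f, fUU, Category.assoc g, gUU, Category.assoc]
    refine mUU.trans ?_
    rw [Category.assoc, aUU, bU]
  have h₁ : e ≫ triHom (tri (tri p q) r) s = f ≫ triHom (tri (tri p q) r) s := h₀
  refine triDir_ext h₁ (triDir_ext_U h₁ (triDir_ext ?_ UUU UUV) UV) V
  exact triU_hom_ext (p := tri p q) (triU_hom_ext h₁)

theorem tri_pentagon_dir (p q r s : Poly E) {B : E} (x : B ⟶ (tri (tri (tri p q) r) s).pos)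
    (d : B ⟶ (tri p (tri q (tri r s))).dir)
    (h : x ≫ Hom.pos (triMap (assocHom p q r) (𝟙 s) ≫ assocHom p (tri q r) s ≫
        triMap (𝟙 p) (assocHom q r s)) = d ≫ triHom p (tri q (tri r s)))
    (h' : x ≫ Hom.pos (assocHom (tri p q) r s ≫ assocHom p q (tri r s)) =
      d ≫ triHom p (tri q (tri r s))) :
    Hom.app (triMap (assocHom p q r) (𝟙 s) ≫ assocHom p (tri q r) s ≫
        triMap (𝟙 p) (assocHom q r s)) x d h =
      Hom.app (assocHom (tri p q) r s ≫ assocHom p q (tri r s)) x d h' := by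
  refine (comp_app _ _ _ _ _).trans
    ((Hom.app_congr _ _ rfl (comp_app _ _ _ _ _)).trans (Eq.trans ?_ (comp_app _ _ _ _ _).symm))
  exact tri_pentagon_aux _ _ _ _ _ _ _ _ _ _

theorem tri_pentagon (p q r s : Poly E) :
    triMap (assocHom p q r) (𝟙 s) ≫ assocHom p (tri q r) s ≫ triMap (𝟙 p) (assocHom q r s) =
      assocHom (tri p q) r s ≫ assocHom p q (tri r s) :=
  tri_hom_ext (fun _ x => tri_pentagon_pos p q r s x)
    (fun _ x d h h' => tri_pentagon_dir p q r s x d h h')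

theorem tri_triangle (p q : Poly E) :
    assocHom p y q ≫ triMap (𝟙 p) (leftHom q) = triMap (rightHom p) (𝟙 q) := by
  apply tri_hom_ext
  · intro B x
    apply triPos_ext
    · simp
    · intro C w u h h'
      simp [leftPos]
  · intro B x d h h'
    apply triDir_ext
    · simp
    · apply triDir_ext
      · simp
      · simp
      · exact one_ext' _ _
    · simp

instance : MonoidalCategoryStruct (Poly E) where
  tensorObj := tri
  whiskerLeft p _ _ φ := triMap (𝟙 p) φ
  whiskerRight φ p := triMap φ (𝟙 p)
  tensorHom := triMap
  tensorUnit := y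
  associator := assocIso
  leftUnitor := leftIso
  rightUnitor := rightIso

/-- Polynomials form a monoidal category under the composition product. -/
instance : MonoidalCategory (Poly E) :=
  MonoidalCategory.ofTensorHom
    (id_tensorHom_id := triMap_id)
    (id_tensorHom := fun _ _ _ _ => rfl)
    (tensorHom_id := fun _ _ => rfl)
    (tensorHom_comp_tensorHom := fun f₁ f₂ g₁ g₂ => triMap_comp f₁ f₂ g₁ g₂)
    (associator_naturality := fun f₁ f₂ f₃ => assoc_naturality f₁ f₂ f₃)
    (leftUnitor_naturality := fun f => left_naturality f)
    (rightUnitor_naturality := fun f => right_naturality f)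
    (pentagon := tri_pentagon)
    (triangle := tri_triangle)

end Monoidal

end Poly


section Internal

variable (E) in
/-- A category internal to `E`. -/
structure InternalCategory where
  /-- the object of objects -/
  obj : E
  /-- the object of arrows -/
  arr : E
  /-- source -/
  src : arr ⟶ obj
  /-- target -/
  tgt : arr ⟶ obj
  /-- identities -/
  ident : obj ⟶ arr
  /-- composition of `f` and `g` with `tgt f = src g`, in this order -/
  mul : pullback tgt src ⟶ arr
  ident_src : ident ≫ src = 𝟙 obj
  ident_tgt : ident ≫ tgt = 𝟙 obj
  mul_src : mul ≫ src = pullback.fst tgt src ≫ src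
  mul_tgt : mul ≫ tgt = pullback.snd tgt src ≫ tgt
  ident_mul : pullback.lift (src ≫ ident) (𝟙 arr) (by simp [ident_tgt]) ≫ mul = 𝟙 arr
  mul_ident : pullback.lift (𝟙 arr) (tgt ≫ ident) (by simp [ident_src]) ≫ mul = 𝟙 arr
  mul_assoc :
    pullback.lift (pullback.fst (pullback.snd tgt src ≫ tgt) src ≫ mul)
        (pullback.snd (pullback.snd tgt src ≫ tgt) src)
        (by rw [Category.assoc, mul_tgt, pullback.condition]) ≫ mul =
      pullback.lift (pullback.fst (pullback.snd tgt src ≫ tgt) src ≫ pullback.fst tgt src)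
        (pullback.lift (pullback.fst (pullback.snd tgt src ≫ tgt) src ≫ pullback.snd tgt src)
          (pullback.snd (pullback.snd tgt src ≫ tgt) src)
          (by rw [Category.assoc, pullback.condition]) ≫ mul)
        (by simp [mul_src, pullback.condition]) ≫ mul

/-- An internal cofunctor. An isomorphism class of the defining diagrams, where the isomorphisms
are between choices of the pullback of `D.src` along `pos`, has exactly one member whose pullback
is the chosen one. -/
structure Cofunctor (C D : InternalCategory E) where
  /-- the component on objects -/
  pos : C.obj ⟶ D.obj
  /-- the component on arrows -/
  dir : pullback pos D.src ⟶ C.arr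
  dir_src : dir ≫ C.src = pullback.fst pos D.src
  map_ident : pullback.lift (𝟙 C.obj) (pos ≫ D.ident) (by simp [D.ident_src]) ≫ dir = C.ident
  map_tgt : dir ≫ C.tgt ≫ pos = pullback.snd pos D.src ≫ D.tgt
  map_mul :
    pullback.lift
        (pullback.fst (pullback.snd pos D.src ≫ D.tgt) D.src ≫ pullback.fst pos D.src)
        (pullback.lift
          (pullback.fst (pullback.snd pos D.src ≫ D.tgt) D.src ≫ pullback.snd pos D.src)
          (pullback.snd (pullback.snd pos D.src ≫ D.tgt) D.src)
          (by rw [Category.assoc, pullback.condition]) ≫ D.mul)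
        (by simp [D.mul_src, pullback.condition]) ≫ dir =
      pullback.lift
        (pullback.fst (pullback.snd pos D.src ≫ D.tgt) D.src ≫ dir)
        (pullback.lift
          (pullback.fst (pullback.snd pos D.src ≫ D.tgt) D.src ≫ dir ≫ C.tgt)
          (pullback.snd (pullback.snd pos D.src ≫ D.tgt) D.src)
          (by simp only [Category.assoc, map_tgt, ← pullback.condition]) ≫ dir)
        (by simp [dir_src]) ≫ C.mul

/-- Composition of generalized arrows. -/
def InternalCategory.gmul (C : InternalCategory E) {B : E} (f g : B ⟶ C.arr)
    (h : f ≫ C.tgt = g ≫ C.src) : B ⟶ C.arr :=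
  pullback.lift f g h ≫ C.mul

namespace Cofunctor

variable {C D D' : InternalCategory E}

/-- The action on generalized elements of the component on arrows. -/
def app (φ : Cofunctor C D) {B : E} (x : B ⟶ C.obj) (f : B ⟶ D.arr)
    (h : x ≫ φ.pos = f ≫ D.src) : B ⟶ C.arr :=
  pullback.lift x f h ≫ φ.dir

theorem app_congr (φ : Cofunctor C D) {B : E} {x x' : B ⟶ C.obj} {f f' : B ⟶ D.arr}
    (h : x ≫ φ.pos = f ≫ D.src) (hx : x = x') (hf : f = f') :
    φ.app x f h = φ.app x' f' (by rw [← hx, ← hf, h]) := by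
  subst hx hf
  rfl

@[simp] theorem comp_app (φ : Cofunctor C D) {A B : E} (w : A ⟶ B) (x : B ⟶ C.obj)
    (f : B ⟶ D.arr) (h : x ≫ φ.pos = f ≫ D.src) :
    w ≫ φ.app x f h = φ.app (w ≫ x) (w ≫ f) (by simp [h]) := by
  simp only [app, ← Category.assoc, comp_lift]

@[simp] theorem comp_gmul {A B : E} (w : A ⟶ B) (f g : B ⟶ C.arr) (h : f ≫ C.tgt = g ≫ C.src) :
    w ≫ C.gmul f g h = C.gmul (w ≫ f) (w ≫ g) (by simp [h]) := by
  simp only [InternalCategory.gmul, ← Category.assoc, comp_lift]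

@[simp] theorem app_src (φ : Cofunctor C D) {B : E} (x : B ⟶ C.obj) (f : B ⟶ D.arr)
    (h : x ≫ φ.pos = f ≫ D.src) : φ.app x f h ≫ C.src = x := by
  rw [app, Category.assoc, φ.dir_src, pullback.lift_fst]

@[simp] theorem app_src_assoc (φ : Cofunctor C D) {B Z : E} (x : B ⟶ C.obj) (f : B ⟶ D.arr)
    (h : x ≫ φ.pos = f ≫ D.src) (k : C.obj ⟶ Z) : φ.app x f h ≫ C.src ≫ k = x ≫ k := by
  rw [← Category.assoc, app_src]

@[simp] theorem app_tgt (φ : Cofunctor C D) {B : E} (x : B ⟶ C.obj) (f : B ⟶ D.arr)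
    (h : x ≫ φ.pos = f ≫ D.src) : φ.app x f h ≫ C.tgt ≫ φ.pos = f ≫ D.tgt := by
  rw [app, Category.assoc, φ.map_tgt, ← Category.assoc, pullback.lift_snd]

@[simp] theorem app_tgt_assoc (φ : Cofunctor C D) {B Z : E} (x : B ⟶ C.obj) (f : B ⟶ D.arr)
    (h : x ≫ φ.pos = f ≫ D.src) (k : D.obj ⟶ Z) :
    φ.app x f h ≫ C.tgt ≫ φ.pos ≫ k = f ≫ D.tgt ≫ k := by
  rw [← Category.assoc C.tgt, ← Category.assoc, app_tgt, Category.assoc]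

theorem app_ident (φ : Cofunctor C D) {B : E} (x : B ⟶ C.obj)
    (h : x ≫ φ.pos = (x ≫ φ.pos ≫ D.ident) ≫ D.src) :
    φ.app x (x ≫ φ.pos ≫ D.ident) h = x ≫ C.ident := by
  have := congrArg (fun k => x ≫ k) φ.map_ident
  simpa [app, comp_lift, ← Category.assoc] using this

theorem app_gmul (φ : Cofunctor C D) {B : E} (x : B ⟶ C.obj) (f g : B ⟶ D.arr)
    (h : x ≫ φ.pos = f ≫ D.src) (h' : f ≫ D.tgt = g ≫ D.src)
    (h'' : x ≫ φ.pos = D.gmul f g h' ≫ D.src) :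
    φ.app x (D.gmul f g h') h'' =
      C.gmul (φ.app x f h) (φ.app (φ.app x f h ≫ C.tgt) g (by simp [h'])) (by simp) := by
  have := congrArg (fun k => pullback.lift (f := pullback.snd φ.pos D.src ≫ D.tgt)
    (pullback.lift x f h) g (by simpa using h') ≫ k) φ.map_mul
  simpa [app, InternalCategory.gmul, comp_lift, ← Category.assoc] using this

theorem dir_eq (φ : Cofunctor C D) : φ.dir = φ.app (pullback.fst _ _) (pullback.snd _ _)
    pullback.condition := by
  have : pullback.lift (pullback.fst φ.pos D.src) (pullback.snd φ.pos D.src)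
      pullback.condition = 𝟙 _ := by
    apply pullback.hom_ext <;> simp
  simp [app, this]

theorem ext_app {φ ψ : Cofunctor C D} (h₁ : φ.pos = ψ.pos)
    (h₂ : ∀ (B : E) (x : B ⟶ C.obj) (f : B ⟶ D.arr) (h : x ≫ φ.pos = f ≫ D.src)
      (h' : x ≫ ψ.pos = f ≫ D.src), φ.app x f h = ψ.app x f h') : φ = ψ := by
  have a := dir_eq φ
  have b := dir_eq ψ
  obtain ⟨f, d, _⟩ := φ
  obtain ⟨f', d', _⟩ := ψ
  obtain rfl : f = f' := h₁
  obtain rfl : d = d' := by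
    exact a.trans ((h₂ _ _ _ _ pullback.condition).trans b.symm)
  rfl

/-- The identity cofunctor. -/
def id (C : InternalCategory E) : Cofunctor C C where
  pos := 𝟙 C.obj
  dir := pullback.snd (𝟙 C.obj) C.src
  dir_src := by simp [← pullback.condition]
  map_ident := by simp
  map_tgt := by simp
  map_mul := by
    simp only [pullback.lift_snd]

/-- The component on arrows of the composite of internal cofunctors: the composite of
`C.obj ×_{D'.obj} D'.arr ⟶ C.obj ×_{D.obj} D.arr`, induced by `ψ.dir`, with `φ.dir`. -/
def compDir (φ : Cofunctor C D) (ψ : Cofunctor D D') :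
    pullback (φ.pos ≫ ψ.pos) D'.src ⟶ C.arr :=
  φ.app (pullback.fst (φ.pos ≫ ψ.pos) D'.src)
    (ψ.app (pullback.fst (φ.pos ≫ ψ.pos) D'.src ≫ φ.pos) (pullback.snd (φ.pos ≫ ψ.pos) D'.src)
      (by simp [← pullback.condition])) (by simp)

theorem lift_compDir (φ : Cofunctor C D) (ψ : Cofunctor D D') {B : E} (x : B ⟶ C.obj)
    (f : B ⟶ D'.arr) (h : x ≫ φ.pos ≫ ψ.pos = f ≫ D'.src) :
    pullback.lift x f h ≫ compDir φ ψ =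
      φ.app x (ψ.app (x ≫ φ.pos) f (by simpa using h)) (by simp) := by
  rw [compDir, comp_app]
  refine app_congr _ _ (pullback.lift_fst _ _ _) ?_
  rw [comp_app]
  refine app_congr _ _ ?_ (pullback.lift_snd _ _ _)
  rw [← Category.assoc, pullback.lift_fst]

theorem gmul_congr {B : E} {f f' g g' : B ⟶ C.arr} (h : f ≫ C.tgt = g ≫ C.src) (hf : f = f')
    (hg : g = g') : C.gmul f g h = C.gmul f' g' (by rw [← hf, ← hg, h]) := by
  subst hf hg
  rfl

theorem compDir_mul (φ : Cofunctor C D) (ψ : Cofunctor D D') {B : E}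
    (a : B ⟶ pullback (φ.pos ≫ ψ.pos) D'.src) (g : B ⟶ D'.arr)
    (hg : (a ≫ pullback.snd (φ.pos ≫ ψ.pos) D'.src) ≫ D'.tgt = g ≫ D'.src)
    (h₁ : (a ≫ pullback.fst (φ.pos ≫ ψ.pos) D'.src) ≫ φ.pos ≫ ψ.pos =
      (pullback.lift (a ≫ pullback.snd (φ.pos ≫ ψ.pos) D'.src) g hg ≫ D'.mul) ≫ D'.src)
    (h₂ : (a ≫ compDir φ ψ ≫ C.tgt) ≫ φ.pos ≫ ψ.pos = g ≫ D'.src)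
    (h₃ : (a ≫ compDir φ ψ) ≫ C.tgt =
      (pullback.lift (a ≫ compDir φ ψ ≫ C.tgt) g h₂ ≫ compDir φ ψ) ≫ C.src) :
    pullback.lift (a ≫ pullback.fst (φ.pos ≫ ψ.pos) D'.src)
        (pullback.lift (a ≫ pullback.snd (φ.pos ≫ ψ.pos) D'.src) g hg ≫ D'.mul) h₁ ≫
          compDir φ ψ =
      pullback.lift (a ≫ compDir φ ψ)
        (pullback.lift (a ≫ compDir φ ψ ≫ C.tgt) g h₂ ≫ compDir φ ψ) h₃ ≫ C.mul := by
  have hx : ((a ≫ pullback.fst (φ.pos ≫ ψ.pos) D'.src) ≫ φ.pos) ≫ ψ.pos =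
      (a ≫ pullback.snd (φ.pos ≫ ψ.pos) D'.src) ≫ D'.src := by
    simp only [Category.assoc]
    rw [← pullback.condition]
  have ha : a ≫ compDir φ ψ = φ.app (a ≫ pullback.fst (φ.pos ≫ ψ.pos) D'.src)
      (ψ.app ((a ≫ pullback.fst (φ.pos ≫ ψ.pos) D'.src) ≫ φ.pos)
        (a ≫ pullback.snd (φ.pos ≫ ψ.pos) D'.src) hx) (by simp) := by
    rw [compDir, comp_app]
    refine app_congr _ _ rfl ?_
    rw [comp_app]
    exact app_congr _ _ (Category.assoc _ _ _).symm rfl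
  have hb : a ≫ compDir φ ψ ≫ C.tgt = φ.app (a ≫ pullback.fst (φ.pos ≫ ψ.pos) D'.src)
      (ψ.app ((a ≫ pullback.fst (φ.pos ≫ ψ.pos) D'.src) ≫ φ.pos)
        (a ≫ pullback.snd (φ.pos ≫ ψ.pos) D'.src) hx) (by simp) ≫ C.tgt := by
    rw [← ha, Category.assoc]
  rw [lift_compDir]
  refine (app_congr φ _ rfl (app_gmul ψ _ _ g hx hg ((Category.assoc _ _ _).trans h₁))).trans ?_
  rw [app_gmul φ _ _ _ (by simp) (by simp)]
  refine gmul_congr _ ha.symm ?_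
  rw [lift_compDir]
  refine app_congr φ _ hb.symm (app_congr ψ _ ?_ rfl)
  exact ((congrArg (fun k => k ≫ φ.pos) hb).trans
    ((Category.assoc _ _ _).trans (app_tgt φ _ _ _))).symm

/-- The composite of internal cofunctors. -/
def comp (φ : Cofunctor C D) (ψ : Cofunctor D D') : Cofunctor C D' where
  pos := φ.pos ≫ ψ.pos
  dir := compDir φ ψ
  dir_src := by simp [compDir]
  map_ident := by
    rw [lift_compDir]
    refine (app_congr φ (x' := 𝟙 _ ) (f' := 𝟙 _ ≫ φ.pos ≫ D.ident) _ rfl ?_).trans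
      ((app_ident φ (𝟙 _ ) (by simp [D.ident_src])).trans (Category.id_comp _))
    refine (app_congr ψ (x' := φ.pos) (f' := φ.pos ≫ ψ.pos ≫ D'.ident) _
      (Category.id_comp _) (Category.assoc _ _ _)).trans ?_
    rw [app_ident, Category.id_comp]
  map_tgt := by
    rw [← Category.assoc C.tgt, ← Category.assoc]
    simp [compDir]
  map_mul := compDir_mul φ ψ _ _ _ _ _ _

theorem id_app (C : InternalCategory E) {B : E} (x : B ⟶ C.obj) (f : B ⟶ C.arr)
    (h : x ≫ (Cofunctor.id C).pos = f ≫ C.src) : (Cofunctor.id C).app x f h = f :=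
  pullback.lift_snd _ _ _

theorem comp_app' (φ : Cofunctor C D) (ψ : Cofunctor D D') {B : E} (x : B ⟶ C.obj)
    (f : B ⟶ D'.arr) (h : x ≫ (Cofunctor.comp φ ψ).pos = f ≫ D'.src) :
    (Cofunctor.comp φ ψ).app x f h =
      φ.app x (ψ.app (x ≫ φ.pos) f (by simpa [comp] using h)) (by simp) :=
  lift_compDir φ ψ x f h

end Cofunctor

instance : Category (InternalCategory E) where
  Hom C D := Cofunctor C D
  id C := Cofunctor.id C
  comp φ ψ := Cofunctor.comp φ ψ
  id_comp φ := by
    refine Cofunctor.ext_app (Category.id_comp _) ?_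
    intro B x f h h'
    rw [Cofunctor.comp_app', Cofunctor.id_app]
    exact Cofunctor.app_congr _ _ (Category.comp_id _) rfl
  comp_id φ := by
    refine Cofunctor.ext_app (Category.comp_id _) ?_
    intro B x f h h'
    rw [Cofunctor.comp_app']
    exact Cofunctor.app_congr _ _ rfl (Cofunctor.id_app _ _ _ _)
  assoc φ ψ χ := by
    refine Cofunctor.ext_app (Category.assoc _ _ _) ?_
    intro B x f h h'
    rw [Cofunctor.comp_app', Cofunctor.comp_app', Cofunctor.comp_app']
    refine Cofunctor.app_congr _ _ rfl ?_
    rw [Cofunctor.comp_app']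
    exact Cofunctor.app_congr _ _ rfl (Cofunctor.app_congr _ _ (Category.assoc _ _ _).symm rfl)

variable (E) in
/-- The category of internal categories in `E` whose source morphism is exponentiable, and
internal cofunctors. -/
abbrev ExpInternalCategory : Type max u v :=
  ObjectProperty.FullSubcategory fun C : InternalCategory E => IsExponentiable C.src

variable (E) in
/-- The functor that sends an internal category to its source morphism and an internal cofunctor
to its underlying morphism of polynomials. -/
def underlyingPoly : ExpInternalCategory E ⥤ Poly E where
  obj C := ⟨C.obj.obj, C.obj.arr, C.obj.src, C.property⟩
  map {C D} φ :=
    have φ' : Cofunctor C.obj D.obj := φ.hom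
    (⟨φ'.pos, φ'.dir, φ'.dir_src⟩ : Poly.Hom _ _)
  map_id C := by
    rfl
  map_comp {C D D'} φ ψ := by
    rfl

end Internal

end

end PolyComon

/-!
A morphism `p ⟶ p ◁ p` that is the identity on positions of the first factor is a map `t` from
directions to positions, sending a position `I` to `I` together with the restriction of `t` to the
directions at `I`, and a map `k` that sends a pair of directions `(f, g)` with `t f = p g` to a
direction at `p f`; a morphism `p ⟶ y` is a section `i` of `p`.

The right counit law, read on positions, says that the first component of the comultiplication is
the identity, so a comonoid on `p` consists of such `t`, `k` and `i`. The remaining content of the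
laws is that of an internal category with source `p`: the left counit law is `t i = 1` and
the left unit law, the right counit law is the right unit law, and coassociativity is `t k = t π₂`
on positions and associativity on directions. In the same way homomorphisms are internal
cofunctors. Both translations keep the underlying morphism of polynomials, and the two forgetful
functors to polynomials are faithful, so the functors are inverse as soon as they are on objects.
-/

namespace PolyComon

noncomputable section

attribute [local simp] pullback.lift_fst pullback.lift_fst_assoc pullback.lift_snd
  pullback.lift_snd_assoc

theorem functor_eq_id_of_faithful {A A' : Type*} [Category* A] [Category* A'] (U : A ⥤ A')
    [U.Faithful] {H : A ⥤ A} (hobj : ∀ X, H.obj X = X) (hU : H ⋙ U = U) : H = 𝟭 A := by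
  refine CategoryTheory.Functor.ext hobj fun X Y f => U.map_injective ?_
  simpa [eqToHom_map] using Functor.congr_hom hU f

theorem comonObj_ext {A : Type*} [Category* A] [MonoidalCategory A] {X : A} {c c' : ComonObj X}
    (counit : c.counit = c'.counit) (comul : c.comul = c'.comul) : c = c' := by
  cases c
  cases c'
  cases counit
  cases comul
  rfl

variable {E : Type u} [Category.{v} E] [HasFiniteLimits E]

@[simp] theorem comp_lift_comp {A B X Y Z W : E} {f : X ⟶ Z} {g : Y ⟶ Z} (w : A ⟶ B) (a : B ⟶ X)
    (b : B ⟶ Y) (h : a ≫ f = b ≫ g) (m : pullback f g ⟶ W) :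
    w ≫ pullback.lift a b h ≫ m = pullback.lift (w ≫ a) (w ≫ b) (by simp [h]) ≫ m := by
  rw [← Category.assoc, comp_lift]

theorem lift_comp_fst_comp_snd {A X Y Z : E} {f : X ⟶ Z} {g : Y ⟶ Z} (w : A ⟶ pullback f g)
    (h : (w ≫ pullback.fst f g) ≫ f = (w ≫ pullback.snd f g) ≫ g) :
    pullback.lift (w ≫ pullback.fst f g) (w ≫ pullback.snd f g) h = w := by
  rw [← comp_lift w _ _ pullback.condition, pullback.lift_fst_snd, Category.comp_id]

namespace Poly

variable {p q s : Poly E}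

theorem hom_tri_ext_iff {φ ψ : s ⟶ tri p q} :
    φ = ψ ↔
      (∀ (B : E) (x : B ⟶ s.pos), (x ≫ Hom.pos φ) ≫ triπ p q = (x ≫ Hom.pos ψ) ≫ triπ p q) ∧
      (∀ (B : E) (x : B ⟶ s.pos) (u : B ⟶ p.dir) (h : (x ≫ Hom.pos φ) ≫ triπ p q = u ≫ p.hom)
        (h' : (x ≫ Hom.pos ψ) ≫ triπ p q = u ≫ p.hom),
        ev (x ≫ Hom.pos φ) u h = ev (x ≫ Hom.pos ψ) u h') ∧
      (∀ (B : E) (x : B ⟶ s.pos) (d : B ⟶ (tri p q).dir)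
        (h : x ≫ Hom.pos φ = d ≫ triHom p q) (h' : x ≫ Hom.pos ψ = d ≫ triHom p q),
        Hom.app φ x d h = Hom.app ψ x d h') := by
  refine ⟨?_, fun ⟨hπ, hev, happ⟩ => tri_hom_ext (fun B x => triPos_ext (hπ B x) ?_) happ⟩
  · rintro rfl
    exact ⟨fun _ _ => rfl, fun _ _ _ _ _ => rfl, fun _ _ _ _ _ => rfl⟩
  · intro C w u h h'
    have assoc (k : s.pos ⟶ (tri p q).pos) : w ≫ x ≫ k = (w ≫ x) ≫ k := (Category.assoc _ _ _).symm
    rw [ev_congr h (assoc _) rfl, ev_congr h' (assoc _) rfl]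
    exact hev _ _ _ _ _

/-- The position of `p ◁ q` at the position `x` of `p` whose map from the directions at `x` to the
positions of `q` is the restriction of `t`. -/
def restrictPos (t : p.dir ⟶ q.pos) {B : E} (x : B ⟶ p.pos) : B ⟶ (tri p q).pos :=
  triPos x (pullback.snd x p.hom ≫ t)

section RestrictPos

variable (t : p.dir ⟶ q.pos)

@[simp] theorem comp_restrictPos {B C : E} (w : C ⟶ B) (x : B ⟶ p.pos) :
    w ≫ restrictPos t x = restrictPos t (w ≫ x) :=
  comp_triPos_eq _ _ _ _ _ rfl (by intros; simp)

@[simp] theorem restrictPos_π {B : E} (x : B ⟶ p.pos) : restrictPos t x ≫ triπ p q = x :=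
  triPos_π _ _

@[simp] theorem restrictPos_π_assoc {B Z : E} (x : B ⟶ p.pos) (k : p.pos ⟶ Z) :
    restrictPos t x ≫ triπ p q ≫ k = x ≫ k :=
  triPos_π_assoc _ _ _

@[simp] theorem ev_restrictPos {B : E} (x : B ⟶ p.pos) (u : B ⟶ p.dir)
    (h : restrictPos t x ≫ triπ p q = u ≫ p.hom) : ev (restrictPos t x) u h = u ≫ t := by
  simp [restrictPos]

variable {t}

theorem triU_hom_of_restrictPos {B : E} {x : B ⟶ p.pos} {d : B ⟶ (tri p q).dir}
    (h : restrictPos t x = d ≫ triHom p q) : (d ≫ triU p q) ≫ p.hom = x :=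
  (cond_U h).symm.trans (restrictPos_π t x)

theorem triU_comp_of_restrictPos {B : E} {x : B ⟶ p.pos} {d : B ⟶ (tri p q).dir}
    (h : restrictPos t x = d ≫ triHom p q) : (d ≫ triU p q) ≫ t = (d ≫ triV p q) ≫ q.hom :=
  (ev_restrictPos t x _ _).symm.trans (cond_V h)

/-- A generalized direction of `p ◁ q` over a restriction of `t`, given by a direction of `p` and
one of `q` at its image under `t`. -/
def pairDir {B : E} (f : B ⟶ p.dir) (g : B ⟶ q.dir) (h : f ≫ t = g ≫ q.hom) :
    B ⟶ (tri p q).dir :=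
  triDir (restrictPos t (f ≫ p.hom)) f g (restrictPos_π _ _) (by rw [ev_restrictPos, h])

end RestrictPos

/-- The morphism `p ⟶ y` that a section of `p.hom` determines. -/
def toUnit (i : p.pos ⟶ p.dir) (hi : i ≫ p.hom = 𝟙 p.pos) : p ⟶ y :=
  Hom.ofElements (one _) (fun _ x _ _ => x ≫ i) (fun _ x _ _ => by simp [hi])

section ToUnit

variable {i : p.pos ⟶ p.dir} (hi : i ≫ p.hom = 𝟙 p.pos)

@[simp] theorem toUnit_app {B : E} (x : B ⟶ p.pos) (z : B ⟶ (y : Poly E).dir)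
    (h : x ≫ Hom.pos (toUnit i hi) = z ≫ (y : Poly E).hom) :
    Hom.app (toUnit i hi) x z h = x ≫ i :=
  Hom.ofElements_app _ _ _ (by intros; simp) x z h

theorem hom_y_ext_iff {φ ψ : p ⟶ y} :
    φ = ψ ↔
      Hom.app φ (𝟙 _) (oneDir _) (one_ext _ _) = Hom.app ψ (𝟙 _) (oneDir _) (one_ext _ _) := by
  refine ⟨by rintro rfl; rfl, fun e => hom_ext (one_ext _ _) fun B x z h h' => ?_⟩
  have restrict (χ : p ⟶ y) (k : x ≫ Hom.pos χ = z ≫ (y : Poly E).hom) :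
      Hom.app χ x z k = x ≫ Hom.app χ (𝟙 _) (oneDir _) (one_ext _ _) := by
    rw [Hom.comp_app]
    exact Hom.app_congr _ _ (Category.comp_id x).symm (one_ext' _ _)
  rw [restrict φ, restrict ψ, e]

theorem toUnit_injective {i' : p.pos ⟶ p.dir} (hi' : i' ≫ p.hom = 𝟙 p.pos)
    (e : toUnit i hi = toUnit i' hi') : i = i' := by
  simpa using hom_y_ext_iff.1 e

end ToUnit

/-- The section of `p.hom` that a morphism `p ⟶ y` determines. -/
def unitSection (ε : p ⟶ y) : p.pos ⟶ p.dir := Hom.app ε (𝟙 _) (oneDir _) (one_ext _ _)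

theorem unitSection_hom (ε : p ⟶ y) : unitSection ε ≫ p.hom = 𝟙 p.pos := Hom.app_hom _ _ _ _

theorem toUnit_unitSection (ε : p ⟶ y) : toUnit (unitSection ε) (unitSection_hom ε) = ε :=
  hom_y_ext_iff.2 (by simp [unitSection])

/-- The morphism `p ⟶ p ◁ q` over `p` that sends a position `I` to the restriction of `t` to the
directions at `I`, and that acts on directions by `m`. -/
def toTri (t : p.dir ⟶ q.pos) (m : pullback t q.hom ⟶ p.dir)
    (hm : m ≫ p.hom = pullback.fst t q.hom ≫ p.hom) : p ⟶ tri p q :=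
  Hom.ofElements (restrictPos t (𝟙 _))
    (fun B x d h => pullback.lift (d ≫ triU p q) (d ≫ triV p q)
      (triU_comp_of_restrictPos (x := x) (by simpa using h)) ≫ m)
    (fun B x d h => by
      rw [Category.assoc, hm, pullback.lift_fst_assoc]
      exact triU_hom_of_restrictPos (t := t) (by simpa using h))

section ToTri

variable {t : p.dir ⟶ q.pos} {m : pullback t q.hom ⟶ p.dir}
  (hm : m ≫ p.hom = pullback.fst t q.hom ≫ p.hom)

@[simp] theorem comp_toTri_pos {B : E} (x : B ⟶ p.pos) :
    x ≫ Hom.pos (toTri t m hm) = restrictPos t x := by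
  simp [toTri, Hom.ofElements]

@[simp] theorem comp_toTri_pos_assoc {B Z : E} (x : B ⟶ p.pos) (k : (tri p q).pos ⟶ Z) :
    x ≫ Hom.pos (toTri t m hm) ≫ k = restrictPos t x ≫ k := by
  rw [← Category.assoc, comp_toTri_pos]

@[simp] theorem toTri_app {B : E} (x : B ⟶ p.pos) (d : B ⟶ (tri p q).dir)
    (h : x ≫ Hom.pos (toTri t m hm) = d ≫ triHom p q) :
    Hom.app (toTri t m hm) x d h = pullback.lift (d ≫ triU p q) (d ≫ triV p q)
      (triU_comp_of_restrictPos (x := x) (by rw [← h, comp_toTri_pos])) ≫ m :=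
  Hom.ofElements_app _ _ _ (by intros; simp) x d h

theorem toTri_injective {t' : p.dir ⟶ q.pos} {m' : pullback t' q.hom ⟶ p.dir}
    (hm' : m' ≫ p.hom = pullback.fst t' q.hom ≫ p.hom) (e : toTri t m hm = toTri t' m' hm') :
    t = t' ∧ HEq m m' := by
  obtain ⟨-, hev, happ⟩ := hom_tri_ext_iff.1 e
  obtain rfl : t = t' := by simpa using hev _ p.hom (𝟙 _) (by simp) (by simp)
  have := happ _ (pullback.fst t q.hom ≫ p.hom)
    (pairDir (pullback.fst t q.hom) (pullback.snd t q.hom) pullback.condition)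
    (by simp [pairDir]) (by simp [pairDir])
  simp only [toTri_app, pairDir, triDir_U, triDir_V, pullback.lift_fst_snd,
    Category.id_comp] at this
  exact ⟨rfl, heq_of_eq this⟩

end ToTri

section OfToTri

variable (δ : p ⟶ tri p q) (hδ : Hom.pos δ ≫ triπ p q = 𝟙 p.pos)

/-- The map `t` of a morphism `δ : p ⟶ p ◁ q` over `p`. -/
def triTarget : p.dir ⟶ q.pos := ev (p.hom ≫ Hom.pos δ) (𝟙 _) (by simp [hδ])

include hδ in
theorem comp_pos_eq_restrictPos {B : E} (x : B ⟶ p.pos) :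
    x ≫ Hom.pos δ = restrictPos (triTarget δ hδ) x := by
  apply triPos_ext
  · simp [hδ]
  · intro C w u h h'
    have hu : w ≫ x = u ≫ p.hom := by simpa [hδ] using h
    rw [ev_congr h' (comp_restrictPos _ _ _) rfl, ev_restrictPos, triTarget, comp_ev]
    exact ev_congr _ (by rw [← Category.assoc, hu, Category.assoc]) (Category.comp_id _).symm

/-- The action on directions of a morphism `δ : p ⟶ p ◁ q` over `p`. -/
def triMul : pullback (triTarget δ hδ) q.hom ⟶ p.dir :=
  Hom.app δ (pullback.fst _ _ ≫ p.hom) (pairDir (pullback.fst _ _) (pullback.snd _ _)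
    pullback.condition) (by rw [comp_pos_eq_restrictPos δ hδ]; simp [pairDir])

theorem triMul_hom : triMul δ hδ ≫ p.hom = pullback.fst (triTarget δ hδ) q.hom ≫ p.hom :=
  Hom.app_hom _ _ _ _

theorem lift_triMul {B : E} (f : B ⟶ p.dir) (g : B ⟶ q.dir)
    (h : f ≫ triTarget δ hδ = g ≫ q.hom) :
    pullback.lift f g h ≫ triMul δ hδ = Hom.app δ (f ≫ p.hom) (pairDir f g h)
      (by rw [comp_pos_eq_restrictPos δ hδ]; simp [pairDir]) := by
  refine (Hom.comp_app _ _ _ _ _).trans (Hom.app_congr _ _ (by simp) (triDir_ext ?_ ?_ ?_)) <;>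
    simp [pairDir]

theorem toTri_triTarget_triMul : toTri (triTarget δ hδ) (triMul δ hδ) (triMul_hom δ hδ) = δ := by
  refine tri_hom_ext (fun B x => ?_) (fun B x d h h' => ?_)
  · rw [comp_toTri_pos, comp_pos_eq_restrictPos]
  · have hd : restrictPos (triTarget δ hδ) x = d ≫ triHom p q := by rw [← h, comp_toTri_pos]
    have hx : (d ≫ triU p q) ≫ p.hom = x := triU_hom_of_restrictPos hd
    rw [toTri_app, lift_triMul]
    exact Hom.app_congr _ _ hx (triDir_ext (by simp only [pairDir, triDir_hom, hx, hd])
      (by simp only [pairDir, triDir_U]) (by simp only [pairDir, triDir_V]))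

end OfToTri

section Laws

variable {t : p.dir ⟶ p.pos} {i : p.pos ⟶ p.dir} {m : pullback t p.hom ⟶ p.dir}
  (hi : i ≫ p.hom = 𝟙 p.pos) (hm : m ≫ p.hom = pullback.fst t p.hom ≫ p.hom)

theorem leftPos_restrictPos_toUnit {B : E} (x : B ⟶ p.pos) :
    leftPos (triMapPos (toUnit i hi) (𝟙 p) (restrictPos t x)) = x ≫ i ≫ t := by
  simp [leftPos]

theorem toTri_counit_left_iff :
    toTri t m hm ≫ triMap (toUnit i hi) (𝟙 p) = leftInv p ↔
      ∃ hit : i ≫ t = 𝟙 p.pos,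
        pullback.lift (p.hom ≫ i) (𝟙 p.dir) (by simp [hit]) ≫ m = 𝟙 p.dir := by
  constructor
  · intro e
    obtain ⟨-, hev, happ⟩ := hom_tri_ext_iff.1 e
    have hit : i ≫ t = 𝟙 p.pos := by
      simpa [ev_one, leftPos_restrictPos_toUnit] using
        hev _ (𝟙 _) (oneDir _) (one_ext _ _) (one_ext _ _)
    refine ⟨hit, ?_⟩
    have hdir := happ _ p.hom (triDir (leftInvPos p.hom) (oneDir _) (𝟙 _) (one_ext _ _)
      (by rw [ev_one, leftPos_inv, Category.id_comp])) (by simp [e]) (by simp)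
    simpa using hdir
  · rintro ⟨hit, hunit⟩
    refine hom_tri_ext_iff.2 ⟨fun B x => one_ext _ _, fun B x u h h' => ?_, fun B x d h h' => ?_⟩
    · simp [ev_one, leftPos_restrictPos_toUnit, hit]
    · have hx : x = (d ≫ triV y p) ≫ p.hom := by simpa [ev_one] using cond_V h'
      simpa [hx] using congr((d ≫ triV y p) ≫ $hunit)

theorem toTri_counit_right_iff :
    toTri t m hm ≫ triMap (𝟙 p) (toUnit i hi) = rightInv p ↔
      pullback.lift (𝟙 p.dir) (t ≫ i) (by simp [hi]) ≫ m = 𝟙 p.dir := by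
  constructor
  · intro e
    have hdir := (hom_tri_ext_iff.1 e).2.2 _ p.hom
      (triDir (rightInvPos p.hom) (𝟙 _) (oneDir _) (by simp) (one_ext _ _)) (by simp [e]) (by simp)
    simpa using hdir
  · intro hunit
    refine hom_tri_ext_iff.2 ⟨fun B x => by simp, fun B x u h h' => one_ext _ _,
      fun B x d h h' => ?_⟩
    simpa using congr((d ≫ triU p y) ≫ $hunit)

theorem toTri_coassoc_iff :
    toTri t m hm ≫ triMap (𝟙 p) (toTri t m hm) =
        toTri t m hm ≫ triMap (toTri t m hm) (𝟙 p) ≫ assocHom p p p ↔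
      ∃ hmt : m ≫ t = pullback.snd t p.hom ≫ t,
        pullback.lift (pullback.fst (pullback.snd t p.hom ≫ t) p.hom ≫ m)
            (pullback.snd (pullback.snd t p.hom ≫ t) p.hom)
            (by rw [Category.assoc, hmt, pullback.condition]) ≫ m =
          pullback.lift (pullback.fst (pullback.snd t p.hom ≫ t) p.hom ≫ pullback.fst t p.hom)
            (pullback.lift
                (pullback.fst (pullback.snd t p.hom ≫ t) p.hom ≫ pullback.snd t p.hom)
                (pullback.snd (pullback.snd t p.hom ≫ t) p.hom)
                (by rw [Category.assoc, pullback.condition]) ≫ m)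
            (by rw [Category.assoc, Category.assoc, hm, pullback.lift_fst_assoc, Category.assoc,
                pullback.condition]) ≫ m := by
  constructor
  · intro e
    obtain ⟨-, hev, happ⟩ := hom_tri_ext_iff.1 e
    have hmt : m ≫ t = pullback.snd t p.hom ≫ t := by
      have e₁ := hev _ (pullback.fst t p.hom ≫ p.hom) (pullback.fst t p.hom) (by simp) (by simp)
      have e₂ := ev_congr (u := pullback.snd t p.hom) (by simp [pullback.condition]) e₁ rfl
      simpa [pullback.lift_fst_snd] using e₂.symm
    let f := pullback.fst (pullback.snd t p.hom ≫ t) p.hom ≫ pullback.fst t p.hom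
    let g := pullback.fst (pullback.snd t p.hom ≫ t) p.hom ≫ pullback.snd t p.hom
    let k := pullback.snd (pullback.snd t p.hom ≫ t) p.hom
    have hfg : f ≫ t = g ≫ p.hom := by simp [f, g, pullback.condition]
    have hgk : g ≫ t = k ≫ p.hom := by simp [g, k, pullback.condition]
    have hdir := happ _ (f ≫ p.hom)
      (triDir ((f ≫ p.hom) ≫ Hom.pos (toTri t m hm ≫ triMap (𝟙 p) (toTri t m hm)))
        f (pairDir g k hgk) (by simp) (by simp [pairDir, hfg])) (by simp) (by rw [← e]; simp)
    refine ⟨hmt, ?_⟩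
    simpa [pairDir, f, g, k, lift_comp_fst_comp_snd] using hdir.symm
  · rintro ⟨hmt, hassoc⟩
    refine hom_tri_ext_iff.2 ⟨fun B x => by simp, fun B x u h h' => ?_, fun B x d h h' => ?_⟩
    · exact triPos_ext (by simp) (fun C w v k k' => by simp [hmt])
    · have hV : restrictPos t (d ≫ triU _ _ ≫ t) = (d ≫ triV _ _) ≫ triHom p p := by
        simpa using cond_V h
      have hfg : (d ≫ triU _ _) ≫ t = (d ≫ triV _ _ ≫ triU _ _) ≫ p.hom := by
        simpa using (triU_hom_of_restrictPos hV).symm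
      have hgk : (d ≫ triV _ _ ≫ triU _ _) ≫ t = (d ≫ triV _ _ ≫ triV _ _) ≫ p.hom := by
        simpa using triU_comp_of_restrictPos hV
      have hdir := congr(pullback.lift (f := pullback.snd t p.hom ≫ t) (pullback.lift _ _ hfg)
        (d ≫ triV _ _ ≫ triV _ _) (by simpa using hgk) ≫ $hassoc)
      simpa using hdir.symm

end Laws

theorem app_eq_lift_comp_dir (φ : p ⟶ q) {B : E} (x : B ⟶ p.pos) (z : B ⟶ q.dir)
    (h : x ≫ Hom.pos φ = z ≫ q.hom) : Hom.app φ x z h = pullback.lift x z h ≫ Hom.dir φ :=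
  rfl

section HomLaws

variable (φ : p ⟶ q)

theorem comp_toUnit_eq_iff {i : p.pos ⟶ p.dir} (hi : i ≫ p.hom = 𝟙 p.pos) {i' : q.pos ⟶ q.dir}
    (hi' : i' ≫ q.hom = 𝟙 q.pos) :
    φ ≫ toUnit i' hi' = toUnit i hi ↔
      pullback.lift (𝟙 p.pos) (Hom.pos φ ≫ i') (by simp [hi']) ≫ Hom.dir φ = i := by
  simp [hom_y_ext_iff, app_eq_lift_comp_dir φ]

variable {t : p.dir ⟶ p.pos} {m : pullback t p.hom ⟶ p.dir}
  (hm : m ≫ p.hom = pullback.fst t p.hom ≫ p.hom)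
  {t' : q.dir ⟶ q.pos} {m' : pullback t' q.hom ⟶ q.dir}
  (hm' : m' ≫ q.hom = pullback.fst t' q.hom ≫ q.hom)

theorem comp_toTri_eq_iff :
    φ ≫ toTri t' m' hm' = toTri t m hm ≫ triMap φ φ ↔
      ∃ ht : Hom.dir φ ≫ t ≫ Hom.pos φ = pullback.snd (Hom.pos φ) q.hom ≫ t',
        pullback.lift
            (pullback.fst (pullback.snd (Hom.pos φ) q.hom ≫ t') q.hom ≫
              pullback.fst (Hom.pos φ) q.hom)
            (pullback.lift
                (pullback.fst (pullback.snd (Hom.pos φ) q.hom ≫ t') q.hom ≫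
                  pullback.snd (Hom.pos φ) q.hom)
                (pullback.snd (pullback.snd (Hom.pos φ) q.hom ≫ t') q.hom)
                (by rw [Category.assoc, pullback.condition]) ≫ m')
            (by rw [Category.assoc, Category.assoc, hm', pullback.lift_fst_assoc, Category.assoc,
                pullback.condition]) ≫ Hom.dir φ =
          pullback.lift
            (pullback.fst (pullback.snd (Hom.pos φ) q.hom ≫ t') q.hom ≫ Hom.dir φ)
            (pullback.lift
                (pullback.fst (pullback.snd (Hom.pos φ) q.hom ≫ t') q.hom ≫ Hom.dir φ ≫ t)
                (pullback.snd (pullback.snd (Hom.pos φ) q.hom ≫ t') q.hom)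
                (by simp only [Category.assoc, ht, pullback.condition]) ≫ Hom.dir φ)
            (by simp [Hom.dir_hom]) ≫ m := by
  constructor
  · intro e
    obtain ⟨-, hev, happ⟩ := hom_tri_ext_iff.1 e
    have ht : Hom.dir φ ≫ t ≫ Hom.pos φ = pullback.snd (Hom.pos φ) q.hom ≫ t' := by
      have htgt := hev _ (pullback.fst (Hom.pos φ) q.hom) (pullback.snd (Hom.pos φ) q.hom)
        (by simp [pullback.condition]) (by simp [pullback.condition])
      simpa [app_eq_lift_comp_dir φ, pullback.lift_fst_snd] using htgt.symm
    let x := pullback.fst (pullback.snd (Hom.pos φ) q.hom ≫ t') q.hom ≫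
      pullback.fst (Hom.pos φ) q.hom
    let f := pullback.fst (pullback.snd (Hom.pos φ) q.hom ≫ t') q.hom ≫
      pullback.snd (Hom.pos φ) q.hom
    let g := pullback.snd (pullback.snd (Hom.pos φ) q.hom ≫ t') q.hom
    have hxf : x ≫ Hom.pos φ = f ≫ q.hom := by simp [f, x, pullback.condition]
    have hfg : f ≫ t' = g ≫ q.hom := by simp [f, g, pullback.condition]
    have hdir := happ _ x (pairDir f g hfg) (by simp [pairDir, hxf])
      (by rw [← e]; simp [pairDir, hxf])
    refine ⟨ht, ?_⟩
    simpa [app_eq_lift_comp_dir φ, pairDir, x, f, g, lift_comp_fst_comp_snd] using hdir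
  · rintro ⟨ht, hmul⟩
    refine hom_tri_ext_iff.2 ⟨fun B x => by simp, fun B x u h h' => ?_, fun B x d h h' => ?_⟩
    · have htgt := congr(pullback.lift x u (by simpa using h) ≫ $ht)
      simpa [app_eq_lift_comp_dir φ] using htgt.symm
    · have hd : restrictPos t' (x ≫ Hom.pos φ) = d ≫ triHom q q := by simpa using h
      have hdir := congr(pullback.lift (f := pullback.snd (Hom.pos φ) q.hom ≫ t')
        (pullback.lift x _ (triU_hom_of_restrictPos hd).symm) (d ≫ triV q q)
        (by simpa using triU_comp_of_restrictPos hd) ≫ $hmul)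
      simpa [app_eq_lift_comp_dir φ] using hdir

end HomLaws

section Comonoid

theorem pos_comp_triπ_of_counit_right {δ : p ⟶ tri p q} {ε : q ⟶ y}
    (h : δ ≫ triMap (𝟙 p) ε = rightInv p) : Hom.pos δ ≫ triπ p q = 𝟙 p.pos := by
  have hπ := congr((𝟙 p.pos ≫ Hom.pos $h) ≫ triπ p y)
  simpa using hπ

variable (p) [ComonObj p]

theorem comul_pos_comp_triπ : Hom.pos (ComonObj.comul (X := p)) ≫ triπ p p = 𝟙 p.pos :=
  pos_comp_triπ_of_counit_right (ComonObj.comul_counit p)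

/-- The target morphism of the internal category of a comonoid. -/
def target : p.dir ⟶ p.pos := triTarget ComonObj.comul (comul_pos_comp_triπ p)

/-- The identity morphism of the internal category of a comonoid. -/
def identity : p.pos ⟶ p.dir := unitSection ComonObj.counit

/-- The composition morphism of the internal category of a comonoid. -/
def composition : pullback (target p) p.hom ⟶ p.dir :=
  triMul ComonObj.comul (comul_pos_comp_triπ p)

theorem identity_hom : identity p ≫ p.hom = 𝟙 p.pos := unitSection_hom _

theorem composition_hom : composition p ≫ p.hom = pullback.fst (target p) p.hom ≫ p.hom :=
  triMul_hom _ _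

theorem toUnit_identity : toUnit (identity p) (identity_hom p) = ComonObj.counit :=
  toUnit_unitSection _

theorem toTri_composition :
    toTri (target p) (composition p) (composition_hom p) = ComonObj.comul :=
  toTri_triTarget_triMul _ _

end Comonoid

end Poly

open PolyComon.Poly

/-- The internal category whose source morphism is the underlying polynomial of a comonoid. -/
def InternalCategory.ofComonObj (p : Poly E) [ComonObj p] : InternalCategory E :=
  have left := (toTri_counit_left_iff (identity_hom p) (composition_hom p)).1
    (by rw [toTri_composition, toUnit_identity]; exact ComonObj.counit_comul p)
  have right := (toTri_counit_right_iff (identity_hom p) (composition_hom p)).1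
    (by rw [toTri_composition, toUnit_identity]; exact ComonObj.comul_counit p)
  have coassoc := (toTri_coassoc_iff (composition_hom p)).1
    (by rw [toTri_composition]; exact ComonObj.comul_assoc p)
  { obj := p.pos
    arr := p.dir
    src := p.hom
    tgt := target p
    ident := identity p
    mul := composition p
    ident_src := identity_hom p
    ident_tgt := left.fst
    mul_src := composition_hom p
    mul_tgt := coassoc.fst
    ident_mul := left.snd
    mul_ident := right
    mul_assoc := coassoc.snd }

/-- The internal cofunctor given by a homomorphism of comonoids. -/
def Cofunctor.ofIsComonHom {p q : Poly E} [ComonObj p] [ComonObj q] (φ : p ⟶ q) [IsComonHom φ] :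
    Cofunctor (.ofComonObj p) (.ofComonObj q) :=
  have map_comul := (comp_toTri_eq_iff φ (composition_hom p) (composition_hom q)).1
    (by rw [toTri_composition, toTri_composition]; exact IsComonHom.hom_comul φ)
  { pos := Hom.pos φ
    dir := Hom.dir φ
    dir_src := Hom.dir_hom φ
    map_ident := (comp_toUnit_eq_iff φ (identity_hom p) (identity_hom q)).1
      (by rw [toUnit_identity, toUnit_identity]; exact IsComonHom.hom_counit φ)
    map_tgt := map_comul.fst
    map_mul := map_comul.snd }

section OfInternalCategory

variable {C D : InternalCategory E}

/-- The source morphism of an internal category, as a polynomial. -/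
abbrev InternalCategory.poly (hC : IsExponentiable C.src) : Poly E := ⟨C.obj, C.arr, C.src, hC⟩

open InternalCategory

instance (hC : IsExponentiable C.src) : ComonObj (poly hC) where
  counit := toUnit C.ident C.ident_src
  comul := toTri C.tgt C.mul C.mul_src
  counit_comul :=
    (toTri_counit_left_iff (p := poly hC) C.ident_src C.mul_src).2 ⟨C.ident_tgt, C.ident_mul⟩
  comul_counit := (toTri_counit_right_iff (p := poly hC) C.ident_src C.mul_src).2 C.mul_ident
  comul_assoc := (toTri_coassoc_iff (p := poly hC) C.mul_src).2 ⟨C.mul_tgt, C.mul_assoc⟩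

/-- The morphism of polynomials that underlies an internal cofunctor. -/
def Cofunctor.toHom (ψ : Cofunctor C D) (hC : IsExponentiable C.src) (hD : IsExponentiable D.src) :
    poly hC ⟶ poly hD :=
  (⟨ψ.pos, ψ.dir, ψ.dir_src⟩ : Poly.Hom (poly hC) (poly hD))

instance (ψ : Cofunctor C D) (hC : IsExponentiable C.src) (hD : IsExponentiable D.src) :
    IsComonHom (ψ.toHom hC hD) where
  hom_counit := (comp_toUnit_eq_iff (ψ.toHom hC hD) C.ident_src D.ident_src).2 ψ.map_ident
  hom_comul := (comp_toTri_eq_iff (ψ.toHom hC hD) C.mul_src D.mul_src).2 ⟨ψ.map_tgt, ψ.map_mul⟩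

theorem InternalCategory.ofComonObj_poly (hC : IsExponentiable C.src) :
    ofComonObj (poly hC) = C := by
  obtain ⟨ht, hm⟩ := toTri_injective (p := poly hC) _ C.mul_src (toTri_composition (poly hC))
  have hi := toUnit_injective (p := poly hC) _ C.ident_src (toUnit_identity (poly hC))
  exact (InternalCategory.mk.injEq ..).mpr ⟨rfl, rfl, HEq.rfl, heq_of_eq ht, heq_of_eq hi, hm⟩

end OfInternalCategory

variable (E) in
/-- The functor that sends a comonoid to its internal category. -/
def comonToInternal : Comon (Poly E) ⥤ ExpInternalCategory E where
  obj M := ⟨.ofComonObj M.X, M.X.exp⟩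
  map φ := ObjectProperty.homMk (Cofunctor.ofIsComonHom φ.hom)
  map_id _ := rfl
  map_comp _ _ := rfl

variable (E) in
/-- The functor that sends an internal category to its comonoid. -/
def internalToComon : ExpInternalCategory E ⥤ Comon (Poly E) where
  obj C := ⟨InternalCategory.poly C.property⟩
  map {C D} ψ := ⟨Cofunctor.toHom ψ.hom C.property D.property⟩
  map_id _ := rfl
  map_comp _ _ := rfl

instance : (underlyingPoly E).Faithful where
  map_injective {C D} φ ψ h := by
    obtain ⟨⟨pos, dir, _⟩⟩ := φ
    cases h
    rfl

theorem comonToInternal_obj_internalToComon (M : Comon (Poly E)) :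
    (comonToInternal E ⋙ internalToComon E).obj M = M :=
  congrArg (@Comon.mk _ _ _ M.X) (comonObj_ext (toUnit_identity M.X) (toTri_composition M.X))

theorem internalToComon_obj_comonToInternal (C : ExpInternalCategory E) :
    (internalToComon E ⋙ comonToInternal E).obj C = C :=
  ObjectProperty.FullSubcategory.ext (InternalCategory.ofComonObj_poly C.property)

theorem comonToInternal_comp_internalToComon :
    comonToInternal E ⋙ internalToComon E = 𝟭 (Comon (Poly E)) :=
  functor_eq_id_of_faithful (Comon.forget (Poly E)) comonToInternal_obj_internalToComon rfl

theorem internalToComon_comp_comonToInternal :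
    internalToComon E ⋙ comonToInternal E = 𝟭 (ExpInternalCategory E) :=
  functor_eq_id_of_faithful (underlyingPoly E) internalToComon_obj_comonToInternal rfl

end

end PolyComon

theorem mainTheorem3 {E : Type u} [Category.{v} E] [HasFiniteLimits E] :
    ∃ (F : Comon (PolyComon.Poly E) ⥤ PolyComon.ExpInternalCategory E)
      (G : PolyComon.ExpInternalCategory E ⥤ Comon (PolyComon.Poly E)),
      F ⋙ G = 𝟭 (Comon (PolyComon.Poly E)) ∧
      G ⋙ F = 𝟭 (PolyComon.ExpInternalCategory E) ∧
      F ⋙ PolyComon.underlyingPoly E = Comon.forget (PolyComon.Poly E) :=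
  ⟨PolyComon.comonToInternal E, PolyComon.internalToComon E,
    PolyComon.comonToInternal_comp_internalToComon,
    PolyComon.internalToComon_comp_comonToInternal, rfl⟩
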